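/- Let $\mathcal C$ be a unitary tensor category (a rigid $\mathrm C^*$-tensor category with finite direct sums, subobjects, simple unit object $1_{\mathcal C}$ and countably many isomorphism classes of simple objects). Let $A$, $B$ be $\mathrm C^*$-algebras and let $(\alpha,\mathfrak u)$, $(\beta,\mathfrak v)$ be actions of $\mathcal C$ on $A$ and $B$, i.e. $\mathrm C^*$-tensor functors into the nondegenerate $A$-$A$- (resp. $B$-$B$-) correspondences, with unitary, bilinear, natural and associative structure maps $\mathfrak u_{X,Y}\colon\alpha(X)\otimes\alpha(Y)\to\alpha(X\otimes Y)$, $\mathfrak v_{X,Y}\colon\beta(X)\otimes\beta(Y)\to\beta(X\otimes Y)$ and compatible identifications $\alpha(1_{\mathcal C})=A$, $\beta(1_{\mathcal C})=B$. Here $\otimes$ of correspondences is the interior tensor product, and $\rhd$, $\lhd$ denote left and right actions. Let $\phi\colon A\to\mathcal M(B)$ be a (possibly degenerate) $*$-homomorphism and ${}_\phi B$ the $A$-$B$-correspondence $B$ with left action given by $\phi$. A family $\mathbb u=\{\mathbb u_X\}_{X\in\mathcal C}$ makes $(\phi,\mathbb u)$ a $\mathcal C$-cocycle representation if the $\mathbb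 u_X\colon\alpha(X)\otimes{}_\phi B\to{}_\phi B\otimes\beta(X)$ are $A$-$B$-bilinear (not necessarily adjointable) isometries, natural in $X$, such that for all $X,Y\in\mathcal C$, up to the canonical associativity isomorphisms, $$\mathbb u_{X\otimes Y}\,(\mathfrak u_{X,Y}\otimes\mathrm{id}_{{}_\phi B})=(\mathrm{id}_{{}_\phi B}\otimes\mathfrak v_{X,Y})\,(\mathbb u_X\otimes\mathrm{id}_{\beta(Y)})\,(\mathrm{id}_{\alpha(X)}\otimes\mathbb u_Y).$$ Let $\mathcal L(B,\beta(X))$ be the space of adjointable operators, with $\langle f,g\rangle=f^*g\in\mathcal L(B)=\mathcal M(B)$, left action of $\mathcal M(B)$ by post-composition with the canonical extension to $\mathcal M(B)$ of the nondegenerate left action of $B$ on $\beta(X)$, and right action of $\mathcal M(B)$ by pre-composition. Let $l_{\beta(X)}\colon\beta(X)\to B\otimes\beta(X)$ be the inverse of the canonical unitary $b\otimes\eta\mapsto b\rhd\eta$. Then the formula $$\mathbb u_X(\xi\otimes b)=l_{\beta(X)}\big(\phi_X(\xi)(b)\big)\qquad(X\in\mathcal C,\ \xi\in\alpha(X),\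 b\in B)$$ defines a one-to-one correspondence between the families $\mathbb u$ such that $(\phi,\mathbb u)$ is a $\mathcal C$-cocycle representation and the families of linear maps $\{\phi_X\colon\alpha(X)\to\mathcal L(B,\beta(X))\}_{X\in\mathcal C}$ such that for all $X,Y\in\mathcal C$, $a\in A$, $\xi,\eta\in\alpha(X)$ and $\zeta\in\alpha(Y)$: (i) $\phi_{1_{\mathcal C}}(a)=\phi(a)$; (ii) $\phi_X(a\rhd\xi)=\phi(a)\rhd\phi_X(\xi)$ and $\phi_X(\xi\lhd a)=\phi_X(\xi)\lhd\phi(a)$; (iii) $\phi(\langle\eta,\xi\rangle)=\langle\phi_X(\eta),\phi_X(\xi)\rangle$; (iv) $\phi_{X\otimes Y}(\mathfrak u_{X,Y}(\xi\otimes\zeta))=\mathfrak v_{X,Y}\circ(\phi_X(\xi)\otimes\mathrm{id}_{\beta(Y)})\circ l_{\beta(Y)}\circ\phi_Y(\zeta)$; (v) $\phi_Y\circ\alpha(f)=\beta(f)\circ\phi_X$ for every $f\in\mathrm{Hom}(X,Y)$. -/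

import Mathlib

open CategoryTheory MonoidalCategory
open scoped TensorProduct MultiplierAlgebra ComplexConjugate

set_option linter.unusedSectionVars false

namespace CocycleRep

universe w w₁ w₂ w₃ u v uA uB uC uD

section HilbertModules

/-- A `B`-valued semi-inner product (linear in the second variable) and a compatible right
multiplication by `B` on a complex vector space `V`. -/
structure SemiInner (B : Type uB) [NonUnitalCStarAlgebra B] [PartialOrder B] [StarOrderedRing B]
    (V : Type w) [AddCommGroup V] [Module ℂ V] where
  ip : V →ₗ⋆[ℂ] V →ₗ[ℂ] B
  rsmul : B → V →ₗ[ℂ] V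
  star_ip : ∀ x y, star (ip x y) = ip y x
  ip_self_nonneg : ∀ x, 0 ≤ ip x x
  ip_rsmul : ∀ x y b, ip x (rsmul b y) = ip x y * b

/-- A (right) Hilbert `B`-module: a Banach space whose norm comes from a `B`-valued inner product,
with a compatible right action of `B`. (Definiteness of the inner product follows from `norm_sq`,
and the remaining right module axioms from `ip_rsmul`.) -/
structure HilbMod (B : Type uB) [NonUnitalCStarAlgebra B] [PartialOrder B]
    [StarOrderedRing B] where
  carrier : Type w
  [normed : NormedAddCommGroup carrier]
  [space : NormedSpace ℂ carrier]
  [complete : CompleteSpace carrier]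
  form : SemiInner B carrier
  norm_sq : ∀ x : carrier, ‖x‖ ^ 2 = ‖form.ip x x‖

instance (B : Type uB) [NonUnitalCStarAlgebra B] [PartialOrder B] [StarOrderedRing B] :
    CoeSort (HilbMod.{w} B) (Type w) := ⟨HilbMod.carrier⟩

attribute [instance] HilbMod.normed HilbMod.space HilbMod.complete

variable {A : Type uA} [NonUnitalCStarAlgebra A] [PartialOrder A] [StarOrderedRing A]
variable {B : Type uB} [NonUnitalCStarAlgebra B] [PartialOrder B] [StarOrderedRing B]
variable {C : Type uC} [NonUnitalCStarAlgebra C] [PartialOrder C] [StarOrderedRing C]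
variable {D : Type uD} [NonUnitalCStarAlgebra D] [PartialOrder D] [StarOrderedRing D]

/-- The `B`-valued inner product of a Hilbert `B`-module. -/
def HilbMod.ip (E : HilbMod.{w} B) (x y : E) : B := E.form.ip x y

/-- The right action of `B` on a Hilbert `B`-module. -/
def HilbMod.rsmul (E : HilbMod.{w} B) (x : E) (b : B) : E := E.form.rsmul b x

namespace SemiInner

variable {V : Type w} [AddCommGroup V] [Module ℂ V] (P : SemiInner B V)

lemma ip_rsmul_left (x y : V) (b : B) : P.ip (P.rsmul b x) y = star b * P.ip x y := by
  rw [← P.star_ip, P.ip_rsmul, star_mul, P.star_ip]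

lemma isSelfAdjoint_ip (x : V) : IsSelfAdjoint (P.ip x x) := P.star_ip x x

/-- The seminorm attached to a semi-inner product. -/
noncomputable def snorm (x : V) : ℝ := √‖P.ip x x‖

lemma snorm_nonneg (x : V) : 0 ≤ P.snorm x := Real.sqrt_nonneg _

lemma snorm_sq (x : V) : P.snorm x ^ 2 = ‖P.ip x x‖ := Real.sq_sqrt (norm_nonneg _)

lemma cs_aux (x y : V) (t : ℝ) (ht : 0 ≤ t) :
    (2 * t) * ‖P.ip x y‖ ^ 2 ≤ t ^ 2 * ‖P.ip x x‖ * ‖P.ip x y‖ ^ 2 + ‖P.ip y y‖ := by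
  set a := P.ip x y with ha
  have h0 := P.ip_self_nonneg ((t : ℂ) • P.rsmul a x - y)
  have h1 : P.ip ((t : ℂ) • P.rsmul a x - y) ((t : ℂ) • P.rsmul a x - y)
      = ((t : ℂ) ^ 2) • (star a * P.ip x x * a) - ((2 * t : ℝ) : ℂ) • (star a * a) + P.ip y y := by
    have h2 : P.ip y x = star a := (P.star_ip x y).symm
    simp only [map_sub, LinearMap.map_smulₛₗ, LinearMap.sub_apply, LinearMap.smul_apply, map_smul,
      P.ip_rsmul, P.ip_rsmul_left, h2, ← ha, Complex.conj_ofReal]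
    push_cast
    rw [two_mul, add_smul, sq]
    simp only [mul_assoc, smul_sub, smul_smul]
    abel
  rw [h1] at h0
  have h3 : ((2 * t : ℝ) : ℂ) • (star a * a) ≤
      ((t : ℂ) ^ 2) • (star a * P.ip x x * a) + P.ip y y := by
    rw [← sub_nonneg]; convert h0 using 1; abel
  have h4 : 0 ≤ ((2 * t : ℝ) : ℂ) • (star a * a) := by
    rw [Complex.coe_smul]
    exact smul_nonneg (by positivity) (star_mul_self_nonneg a)
  have h5 := CStarAlgebra.norm_le_norm_of_nonneg_of_le h4 h3
  rw [norm_smul, Complex.norm_real, Real.norm_of_nonneg (by positivity),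
    CStarRing.norm_star_mul_self, ← sq] at h5
  refine h5.trans ((norm_add_le _ _).trans ?_)
  gcongr
  rw [norm_smul, norm_pow, Complex.norm_real, Real.norm_of_nonneg ht, mul_assoc]
  rw [mul_assoc]
  refine mul_le_mul_of_nonneg_left ?_ (sq_nonneg t)
  rw [← mul_assoc (star a)]
  calc ‖star a * P.ip x x * a‖ ≤ ‖star a‖ * ‖P.ip x x‖ * ‖a‖ :=
        (norm_mul_le _ _).trans (by gcongr; exact norm_mul_le _ _)
    _ = ‖P.ip x x‖ * ‖a‖ ^ 2 := by rw [norm_star]; ring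

/-- The Cauchy-Schwarz inequality. -/
lemma norm_ip_le (x y : V) : ‖P.ip x y‖ ≤ P.snorm x * P.snorm y := by
  refine le_of_sq_le_sq ?_ (mul_nonneg (P.snorm_nonneg _) (P.snorm_nonneg _))
  rw [mul_pow, snorm_sq, snorm_sq]
  have key := P.cs_aux x y
  set p := ‖P.ip x x‖ with hp
  set q := ‖P.ip y y‖
  set r := ‖P.ip x y‖ ^ 2 with hr
  have hp0 : 0 ≤ p := norm_nonneg _
  have hq0 : 0 ≤ q := norm_nonneg _
  have hr0 : 0 ≤ r := sq_nonneg _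
  rcases hp0.eq_or_lt with h | h
  · rw [← h] at key ⊢
    by_contra hlt
    push Not at hlt
    have hrp : 0 < r := by simpa using hlt
    have := key ((q + 1) / r) (by positivity)
    have h2 : (2 * ((q + 1) / r)) * r = 2 * (q + 1) := by field_simp
    rw [h2] at this
    simp at this
    linarith
  · have := key p⁻¹ (by positivity)
    have h2 : p⁻¹ ^ 2 * p * r = p⁻¹ * r := by field_simp
    rw [h2] at this
    have h3 : p⁻¹ * r ≤ q := by linarith
    calc r = p * (p⁻¹ * r) := by field_simp
      _ ≤ p * q := by gcongr

lemma snorm_add_le (x y : V) : P.snorm (x + y) ≤ P.snorm x + P.snorm y := by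
  refine le_of_sq_le_sq ?_ (add_nonneg (P.snorm_nonneg _) (P.snorm_nonneg _))
  rw [snorm_sq]
  simp only [map_add, LinearMap.add_apply]
  have h1 := P.norm_ip_le x y
  have h2 := P.norm_ip_le y x
  have h3 := P.snorm_sq x
  have h4 := P.snorm_sq y
  have h5 := norm_add_le (P.ip x x + P.ip y x) (P.ip x y + P.ip y y)
  have h6 := norm_add_le (P.ip x x) (P.ip y x)
  have h7 := norm_add_le (P.ip x y) (P.ip y y)
  nlinarith

lemma snorm_smul (c : ℂ) (x : V) : P.snorm (c • x) = ‖c‖ * P.snorm x := by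
  have : ‖P.ip (c • x) (c • x)‖ = ‖c‖ ^ 2 * ‖P.ip x x‖ := by
    simp only [LinearMap.map_smulₛₗ, LinearMap.smul_apply, norm_smul, RingHom.id_apply,
      RCLike.norm_conj]
    ring
  rw [snorm, this, Real.sqrt_mul (by positivity), Real.sqrt_sq (norm_nonneg _), snorm]

lemma snorm_rsmul_le (b : B) (x : V) : P.snorm (P.rsmul b x) ≤ ‖b‖ * P.snorm x := by
  refine le_of_sq_le_sq ?_ (mul_nonneg (norm_nonneg _) (P.snorm_nonneg _))
  rw [snorm_sq, mul_pow, snorm_sq, P.ip_rsmul, P.ip_rsmul_left]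
  calc ‖star b * P.ip x x * b‖ ≤ ‖star b‖ * ‖P.ip x x‖ * ‖b‖ :=
        (norm_mul_le _ _).trans (by gcongr; exact norm_mul_le _ _)
    _ = ‖b‖ ^ 2 * ‖P.ip x x‖ := by rw [norm_star]; ring

/-- The space `V` with the seminorm of a semi-inner product. -/
def Space (_P : SemiInner B V) : Type w := V

instance : AddCommGroup P.Space := inferInstanceAs (AddCommGroup V)
instance : Module ℂ P.Space := inferInstanceAs (Module ℂ V)

/-- The seminorm as a bundled group seminorm. -/
noncomputable def groupSeminorm : AddGroupSeminorm P.Space where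
  toFun x := P.snorm x
  map_zero' := by
    have h : P.ip 0 0 = 0 := map_zero _
    change P.snorm (0 : V) = 0
    rw [snorm, h, norm_zero, Real.sqrt_zero]
  add_le' := P.snorm_add_le
  neg' x := by
    have h := P.snorm_smul (-1) x
    rw [norm_neg, norm_one, one_mul] at h
    rw [← neg_one_smul ℂ x]
    exact h

noncomputable instance : SeminormedAddCommGroup P.Space :=
  P.groupSeminorm.toSeminormedAddCommGroup

lemma norm_space (x : P.Space) : ‖x‖ = P.snorm x := rfl

noncomputable instance : NormedSpace ℂ P.Space where
  norm_smul_le c x := (P.snorm_smul c x).le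

/-- The identity map from `V` to `V` with its seminorm. -/
def toSpace : V →ₗ[ℂ] P.Space := LinearMap.id

/-- The separated completion of `V` with respect to the seminorm. -/
abbrev Compl : Type w := UniformSpace.Completion P.Space

/-- The canonical map from `V` to its separated completion. -/
noncomputable def ι : V →ₗ[ℂ] P.Compl :=
  (UniformSpace.Completion.toComplL : P.Space →L[ℂ] P.Compl).toLinearMap ∘ₗ P.toSpace

lemma norm_ι (x : V) : ‖P.ι x‖ = P.snorm x := UniformSpace.Completion.norm_coe (E := P.Space) x

lemma denseRange_ι : DenseRange P.ι := UniformSpace.Completion.denseRange_coe (α := P.Space)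

/-- The semi-inner product as a continuous sesquilinear map. -/
noncomputable def ipL : P.Space →L⋆[ℂ] P.Space →L[ℂ] B :=
  LinearMap.mkContinuous₂ (show P.Space →ₗ⋆[ℂ] P.Space →ₗ[ℂ] B from P.ip) 1 fun x y => by
    rw [one_mul]; exact P.norm_ip_le x y

/-- The inner product of the completion, as the continuous extension of the semi-inner product. -/
noncomputable def complIp (x y : P.Compl) : B :=
  (UniformSpace.Completion.isDenseInducing_coe.prodMap
    UniformSpace.Completion.isDenseInducing_coe).extend
      (fun p : P.Space × P.Space => P.ipL p.1 p.2) (x, y)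

lemma continuous_ipL : Continuous fun p : P.Space × P.Space => P.ipL p.1 p.2 := by fun_prop

lemma complIp_ι (x y : V) : P.complIp (P.ι x) (P.ι y) = P.ip x y :=
  (UniformSpace.Completion.isDenseInducing_coe.prodMap
    UniformSpace.Completion.isDenseInducing_coe).extend_eq P.continuous_ipL
      ((x, y) : P.Space × P.Space)

lemma continuous_complIp : Continuous fun p : P.Compl × P.Compl => P.complIp p.1 p.2 := by
  let f : P.Space →+ P.Space →+ B :=
    { toFun := fun x => (P.ipL x).toLinearMap.toAddMonoidHom
      map_zero' := by rw [map_zero]; rfl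
      map_add' := fun x y => by rw [map_add]; rfl }
  have hf : Continuous fun p : P.Space × P.Space => f p.1 p.2 := P.continuous_ipL
  have hu : (fun p : P.Compl × P.Compl => P.complIp p.1 p.2) =
      ((UniformSpace.Completion.isDenseInducing_toCompl P.Space).prodMap
        (UniformSpace.Completion.isDenseInducing_toCompl P.Space)).extend
          (fun p : P.Space × P.Space => f p.1 p.2) := rfl
  rw [hu]
  exact (UniformSpace.Completion.isDenseInducing_toCompl P.Space).extend_Z_bilin
    (UniformSpace.Completion.isDenseInducing_toCompl P.Space) hf

@[fun_prop]
lemma continuous_complIp' {X : Type*} [TopologicalSpace X] {f g : X → P.Compl} (hf : Continuous f)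
    (hg : Continuous g) : Continuous fun x => P.complIp (f x) (g x) :=
  P.continuous_complIp.comp (hf.prodMk hg)

@[elab_as_elim]
lemma compl_induction {p : P.Compl → Prop} (hp : IsClosed {x | p x}) (h : ∀ x, p (P.ι x))
    (x : P.Compl) : p x :=
  UniformSpace.Completion.induction_on x hp h

lemma complIp_add_right (x y z : P.Compl) :
    P.complIp x (y + z) = P.complIp x y + P.complIp x z := by
  refine P.compl_induction (isClosed_eq (by fun_prop) (by fun_prop)) (fun x => ?_) x
  refine P.compl_induction (isClosed_eq (by fun_prop) (by fun_prop)) (fun y => ?_) y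
  refine P.compl_induction (isClosed_eq (by fun_prop) (by fun_prop)) (fun z => ?_) z
  simp only [← map_add, complIp_ι]

lemma complIp_smul_right (c : ℂ) (x y : P.Compl) : P.complIp x (c • y) = c • P.complIp x y := by
  refine P.compl_induction (isClosed_eq (P.continuous_complIp' continuous_id continuous_const)
    ((P.continuous_complIp' continuous_id continuous_const).const_smul c)) (fun x => ?_) x
  refine P.compl_induction (isClosed_eq
    (P.continuous_complIp' continuous_const (continuous_id.const_smul c))
    ((P.continuous_complIp' continuous_const continuous_id).const_smul c)) (fun y => ?_) y
  simp only [← map_smul, complIp_ι]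

lemma star_complIp (x y : P.Compl) : star (P.complIp x y) = P.complIp y x := by
  refine P.compl_induction (isClosed_eq (by fun_prop) (by fun_prop)) (fun x => ?_) x
  refine P.compl_induction (isClosed_eq (by fun_prop) (by fun_prop)) (fun y => ?_) y
  simp only [complIp_ι, P.star_ip]

/-- The right action of `B` as a continuous linear map. -/
noncomputable def rsmulL (b : B) : P.Space →L[ℂ] P.Space :=
  LinearMap.mkContinuous (E := P.Space) (F := P.Space) (P.rsmul b) ‖b‖ (P.snorm_rsmul_le b)

/-- The right action of `B` on the completion. -/
noncomputable def complRsmul (b : B) : P.Compl →L[ℂ] P.Compl :=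
  (P.rsmulL b).completion

lemma complRsmul_ι (b : B) (x : V) : P.complRsmul b (P.ι x) = P.ι (P.rsmul b x) :=
  ContinuousLinearMap.completion_apply_coe (P.rsmulL b) (P.toSpace x)

/-- The inner product and right action on the completion. -/
noncomputable def complForm : SemiInner B P.Compl :=
    { ip := LinearMap.mk₂'ₛₗ _ _ P.complIp
        (fun x y z => by rw [← P.star_complIp, complIp_add_right, star_add]; simp only [star_complIp])
        (fun c x y => by
          rw [← P.star_complIp, complIp_smul_right, star_smul, P.star_complIp]; rfl)
        P.complIp_add_right (fun c x y => P.complIp_smul_right c x y)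
      rsmul := fun b => (P.complRsmul b).toLinearMap
      star_ip := P.star_complIp
      ip_self_nonneg := P.compl_induction
        (CStarAlgebra.isClosed_nonneg.preimage
          (P.continuous_complIp' continuous_id continuous_id)) fun x => by
          simpa [complIp_ι] using P.ip_self_nonneg x
      ip_rsmul := fun x y b => by
        change P.complIp x (P.complRsmul b y) = P.complIp x y * b
        refine P.compl_induction (isClosed_eq (by fun_prop) (by fun_prop)) (fun x => ?_) x
        refine P.compl_induction (isClosed_eq (by fun_prop) (by fun_prop)) (fun y => ?_) y
        simp only [complRsmul_ι, complIp_ι, P.ip_rsmul] }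

/-- The Hausdorff completion of a semi-inner product space, as a Hilbert module. -/
noncomputable def completion : HilbMod.{w} B where
  carrier := P.Compl
  form := P.complForm
  norm_sq := P.compl_induction (isClosed_eq (by fun_prop)
      (continuous_norm.comp (P.continuous_complIp' continuous_id continuous_id))) fun x => by
    change ‖P.ι x‖ ^ 2 = ‖P.complIp (P.ι x) (P.ι x)‖
    rw [norm_ι, snorm_sq, complIp_ι]

end SemiInner

/-- The Hilbert `B`-module `B`, with inner product `⟨x, y⟩ = x⋆ y`. -/
noncomputable def HilbMod.self (B : Type uB) [NonUnitalCStarAlgebra B] [PartialOrder B]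
    [StarOrderedRing B] : HilbMod.{uB} B where
  carrier := B
  form :=
    { ip := LinearMap.mk₂'ₛₗ _ _ (fun x y => star x * y)
        (fun x y z => by rw [star_add, add_mul]) (fun c x y => by rw [star_smul, smul_mul_assoc]; rfl)
        (fun x y z => mul_add _ _ _) (fun c x y => mul_smul_comm _ _ _)
      rsmul := fun b => LinearMap.mulRight ℂ b
      star_ip := fun x y => by simp
      ip_self_nonneg := fun x => star_mul_self_nonneg x
      ip_rsmul := fun x y b => by simp [mul_assoc] }
  norm_sq := fun x => by
    change ‖x‖ ^ 2 = ‖star x * x‖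
    rw [CStarRing.norm_star_mul_self, sq]

/-- An `A`-`B`-correspondence: a Hilbert `B`-module with a (possibly degenerate) left action of `A`
given by a `*`-homomorphism into the adjointable operators. -/
structure Corr (A : Type uA) (B : Type uB) [NonUnitalCStarAlgebra A] [NonUnitalCStarAlgebra B]
    [PartialOrder B] [StarOrderedRing B] extends HilbMod.{w} B where
  lact : A →ₙₐ[ℂ] Module.End ℂ carrier
  ip_lact : ∀ (a : A) (x y : carrier), form.ip (lact a x) y = form.ip x (lact (star a) y)

instance (A : Type uA) (B : Type uB) [NonUnitalCStarAlgebra A] [NonUnitalCStarAlgebra B]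
    [PartialOrder B] [StarOrderedRing B] : CoeSort (Corr.{w} A B) (Type w) :=
  ⟨fun E => E.carrier⟩

/-- Nondegeneracy: `A ▷ E` spans a dense subspace of `E`. -/
def Corr.Nondegenerate (E : Corr.{w} A B) : Prop :=
  Dense (Submodule.span ℂ {z : E | ∃ (a : A) (x : E), z = E.lact a x} : Set E)

section Positivity

lemma exists_negPart {D : Type*} [NonUnitalCStarAlgebra D] [PartialOrder D] [StarOrderedRing D]
    (M : D) (hM : IsSelfAdjoint M) :
    ∃ N c : D, star N = N ∧ N = star c * c ∧ N * M * N = - (star (c * N) * (c * N)) ∧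
      (N = 0 → ∃ d, M = star d * d) := by
  have hN0 : 0 ≤ M⁻ := CFC.negPart_nonneg M
  have hNs : star M⁻ = M⁻ := (IsSelfAdjoint.of_nonneg hN0).star_eq
  obtain ⟨c, hc⟩ := CStarAlgebra.nonneg_iff_eq_star_mul_self.1 hN0
  refine ⟨M⁻, c, hNs, hc, ?_, fun h => CStarAlgebra.nonneg_iff_eq_star_mul_self.1
    (CStarAlgebra.nonneg_iff_isSelfAdjoint_and_negPart_eq_zero.2 ⟨hM, h⟩)⟩
  have h2 : M⁻ * M = - (M⁻ * M⁻) := by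
    have h := congrArg (M⁻ * ·) (CFC.posPart_sub_negPart M hM)
    simp only [mul_sub, CFC.negPart_mul_posPart, zero_sub] at h
    exact h.symm
  rw [h2, star_mul, hNs, neg_mul]
  congr 1
  calc M⁻ * M⁻ * M⁻ = M⁻ * (star c * c) * M⁻ := by rw [← hc]
    _ = M⁻ * star c * (c * M⁻) := by simp only [mul_assoc]

/-- A matrix over a C⋆-algebra which is positive as a quadratic form is of the form `c⋆ c`. -/
lemma exists_factor {n : Type*} [Fintype n] [DecidableEq n] (M : CStarMatrix n n A)
    (hM : IsSelfAdjoint M)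
    (hpos : ∀ x : n → A, 0 ≤ ∑ j, ∑ k, star (x j) * M j k * x k) :
    ∃ c : CStarMatrix n n A, M = star c * c := by
  obtain ⟨N, c, hNs, hc, h1, hfin⟩ := exists_negPart M hM
  apply hfin
  have h3 : ∀ i, 0 ≤ (N * M * N) i i := by
    intro i
    convert hpos (fun k => N k i) using 1
    have : (N * M * N) i i = ∑ k, (∑ j, N i j * M j k) * N k i := by
      simp only [CStarMatrix.mul_apply]
    rw [this, Finset.sum_comm]
    refine Finset.sum_congr rfl fun k _ => ?_
    rw [Finset.sum_mul]
    refine Finset.sum_congr rfl fun j _ => ?_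
    have h5 : N i j = star (N j i) := by
      conv_lhs => rw [← hNs]
      rfl
    rw [h5]
  have h6 : c * N = 0 := by
    ext k i
    have h7 := h3 i
    rw [h1] at h7
    have h8 : (-(star (c * N) * (c * N))) i i
        = - ∑ k, star ((c * N) k i) * (c * N) k i := by
      change -((star (c * N) * (c * N)) i i) = _
      rw [CStarMatrix.mul_apply]
      rfl
    rw [h8, neg_nonneg] at h7
    have h9 : ∀ k ∈ Finset.univ, 0 ≤ star ((c * N) k i) * (c * N) k i :=
      fun k _ => star_mul_self_nonneg _
    have h10 := (Finset.sum_eq_zero_iff_of_nonneg h9).1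
      (le_antisymm h7 (Finset.sum_nonneg h9)) k (Finset.mem_univ k)
    exact (CStarRing.star_mul_self_eq_zero_iff _).1 h10
  have h11 : N * N = 0 := by
    conv_lhs => enter [1]; rw [hc]
    rw [mul_assoc, h6, mul_zero]
  rw [← CStarRing.star_mul_self_eq_zero_iff, hNs, h11]

lemma exists_inr_mul {B : Type uB} [NonUnitalCStarAlgebra B] (u : Unitization ℂ B) (b : B) :
    ∃ c : B, u * (b : Unitization ℂ B) = c :=
  ⟨u.fst • b + u.snd * b, by ext <;> simp⟩

lemma exists_mul_inr {B : Type uB} [NonUnitalCStarAlgebra B] (u : Unitization ℂ B) (b : B) :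
    ∃ c : B, (b : Unitization ℂ B) * u = c :=
  ⟨u.fst • b + b * u.snd, by ext <;> simp⟩

lemma le_of_forall_norm_conj_le {p q : B} (hp : 0 ≤ p) (hq : 0 ≤ q)
    (h : ∀ b : B, ‖star b * p * b‖ ≤ ‖star b * q * b‖) : p ≤ q := by
  have key : ∀ ε : ℝ, 0 < ε →
      (p : Unitization ℂ B) ≤ (q : Unitization ℂ B) + algebraMap ℝ (Unitization ℂ B) ε := by
    intro ε hε
    have hp' : 0 ≤ (p : Unitization ℂ B) := Unitization.inr_nonneg_iff.2 hp
    have hq' : 0 ≤ (q : Unitization ℂ B) := Unitization.inr_nonneg_iff.2 hq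
    have hε' : IsStrictlyPositive (algebraMap ℝ (Unitization ℂ B) ε) :=
      by grind
    set t := (q : Unitization ℂ B) + algebraMap ℝ (Unitization ℂ B) ε with ht
    have htp : IsStrictlyPositive t := hε'.nonneg_add hq'
    have hqt : (q : Unitization ℂ B) ≤ t := le_add_of_nonneg_right hε'.nonneg
    rw [le_iff_norm_sqrt_mul_rpow _ _ hq' htp] at hqt
    rw [le_iff_norm_sqrt_mul_rpow _ _ hp' htp]
    set d := t ^ (-(1 / 2) : ℝ) with hd
    have hs : ∀ r : B, 0 ≤ r → ∀ c : B, ‖CFC.sqrt (r : Unitization ℂ B) * (c : Unitization ℂ B)‖ ^ 2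
        = ‖star c * r * c‖ := by
      intro r hr c
      have h1 : CFC.sqrt (r : Unitization ℂ B) * CFC.sqrt (r : Unitization ℂ B) = r :=
        CFC.sqrt_mul_sqrt_self _ (Unitization.inr_nonneg_iff.2 hr)
      have h2 : star (CFC.sqrt (r : Unitization ℂ B)) = CFC.sqrt (r : Unitization ℂ B) :=
        (IsSelfAdjoint.of_nonneg (CFC.sqrt_nonneg _)).star_eq
      rw [sq, ← CStarRing.norm_star_mul_self, star_mul, h2, mul_assoc, ← mul_assoc (CFC.sqrt _), h1,
        ← mul_assoc, ← Unitization.norm_inr (𝕜 := ℂ) (a := star c * r * c), Unitization.inr_mul,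
        Unitization.inr_mul,
        Unitization.inr_star]
    have hx : ∃ x : B, CFC.sqrt (p : Unitization ℂ B) * d = x := by
      rw [Unitization.sqrt_inr]
      exact exists_mul_inr _ _
    obtain ⟨x, hx⟩ := hx
    rw [hx, Unitization.norm_inr]
    have hbd : ∀ e : B, ‖x * e‖ ≤ ‖e‖ := by
      intro e
      obtain ⟨c, hc⟩ := exists_inr_mul d e
      have h1 : ‖x * e‖ = ‖CFC.sqrt (p : Unitization ℂ B) * (c : Unitization ℂ B)‖ := by
        rw [← hc, ← mul_assoc, hx, ← Unitization.norm_inr (𝕜 := ℂ), Unitization.inr_mul]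
      have h2 : ‖CFC.sqrt (q : Unitization ℂ B) * (c : Unitization ℂ B)‖ ≤ ‖e‖ := by
        rw [← hc, ← mul_assoc]
        refine (norm_mul_le _ _).trans ?_
        rw [Unitization.norm_inr]
        exact mul_le_of_le_one_left (norm_nonneg _) hqt
      rw [h1]
      refine le_trans ?_ h2
      refine le_of_sq_le_sq ?_ (norm_nonneg _)
      rw [hs p hp, hs q hq]
      exact h c
    have h3 := hbd (star x)
    rw [CStarRing.norm_self_mul_star, norm_star] at h3
    by_contra hlt
    push Not at hlt
    nlinarith
  rw [← Unitization.inr_le_iff p q (.of_nonneg hp) (.of_nonneg hq)]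
  rw [← sub_nonneg]
  have hlim : Filter.Tendsto (fun ε : ℝ => (q : Unitization ℂ B) +
      algebraMap ℝ (Unitization ℂ B) ε - (p : Unitization ℂ B)) (nhdsWithin 0 (Set.Ioi 0))
      (nhds ((q : Unitization ℂ B) + algebraMap ℝ (Unitization ℂ B) 0 - (p : Unitization ℂ B))) :=
    (((continuous_const.add (continuous_algebraMap ℝ _)).sub continuous_const).tendsto
      0).mono_left nhdsWithin_le_nhds
  rw [map_zero, add_zero] at hlim
  exact CStarAlgebra.isClosed_nonneg.mem_of_tendsto hlim
    (Filter.eventually_of_mem self_mem_nhdsWithin fun ε hε => sub_nonneg.2 (key ε hε))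

lemma smul_sq_nonneg {b : B} (hb : 0 ≤ b) (r : ℝ) : 0 ≤ ((r : ℂ) ^ 2) • b := by
  rw [← Complex.ofReal_pow, Complex.coe_smul]
  exact smul_nonneg (sq_nonneg r) hb

lemma norm_smul_sq (b : B) (r : ℝ) : ‖((r : ℂ) ^ 2) • b‖ = r ^ 2 * ‖b‖ := by
  rw [norm_smul, norm_pow, Complex.norm_real, Real.norm_eq_abs, sq_abs]

/-- A bounded right linear map satisfies `⟨T x, T x⟩ ≤ ‖T‖² ⟨x, x⟩`. -/
lemma HilbMod.ip_map_le {E : HilbMod.{w₁} B} {E' : HilbMod.{w₂} B} (T : E →L[ℂ] E')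
    (hT : ∀ (x : E) (b : B), T (E.rsmul x b) = E'.rsmul (T x) b) (x : E) :
    E'.form.ip (T x) (T x) ≤ ((‖T‖ : ℂ) ^ 2) • E.form.ip x x := by
  refine le_of_forall_norm_conj_le (E'.form.ip_self_nonneg _)
    (smul_sq_nonneg (E.form.ip_self_nonneg _) _) fun b => ?_
  have h1 : star b * E'.form.ip (T x) (T x) * b =
      E'.form.ip (T (E.rsmul x b)) (T (E.rsmul x b)) := by
    rw [hT]
    unfold HilbMod.rsmul
    rw [E'.form.ip_rsmul, E'.form.ip_rsmul_left]
  have h2 : star b * (((‖T‖ : ℂ) ^ 2) • E.form.ip x x) * b =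
      ((‖T‖ : ℂ) ^ 2) • E.form.ip (E.rsmul x b) (E.rsmul x b) := by
    unfold HilbMod.rsmul
    rw [E.form.ip_rsmul, E.form.ip_rsmul_left, mul_smul_comm, smul_mul_assoc]
  rw [h1, h2, norm_smul_sq, ← E'.norm_sq, ← E.norm_sq, ← mul_pow]
  exact pow_le_pow_left₀ (norm_nonneg _) (T.le_opNorm _) 2

lemma Corr.sum_factor (F : Corr.{w₂} A B) {n : Type*} [Fintype n] (c : CStarMatrix n n A)
    (η : n → F) : ∑ i, ∑ j, F.form.ip (η i) (F.lact ((star c * c) i j) (η j)) =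
      ∑ k, F.form.ip (∑ i, F.lact (c k i) (η i)) (∑ i, F.lact (c k i) (η i)) := by
  have hc' : ∀ i j, (star c * c) i j = ∑ k, star (c k i) * c k j := fun i j => by
    rw [CStarMatrix.mul_apply]; rfl
  simp only [map_sum, LinearMap.sum_apply, hc', map_mul, F.ip_lact, Module.End.mul_apply]
  rw [Finset.sum_comm]
  conv_rhs => rw [Finset.sum_comm]
  refine Finset.sum_congr rfl fun j _ => ?_
  rw [Finset.sum_comm]

lemma Corr.sum_nonneg (F : Corr.{w₂} A B) {n : Type*} [Fintype n] [DecidableEq n]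
    (M : CStarMatrix n n A) (hM : IsSelfAdjoint M)
    (hpos : ∀ x : n → A, 0 ≤ ∑ j, ∑ k, star (x j) * M j k * x k) (η : n → F) :
    0 ≤ ∑ i, ∑ j, F.form.ip (η i) (F.lact (M i j) (η j)) := by
  obtain ⟨c, rfl⟩ := exists_factor M hM hpos
  rw [F.sum_factor]
  exact Finset.sum_nonneg fun k _ => F.form.ip_self_nonneg _

/-- The Gram matrix of a finite family of vectors. -/
def HilbMod.gram (E : HilbMod.{w₁} A) {n : Type*} (ξ : n → E) : CStarMatrix n n A :=
  CStarMatrix.ofMatrix fun i j => E.form.ip (ξ i) (ξ j)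

lemma HilbMod.gram_isSelfAdjoint (E : HilbMod.{w₁} A) {n : Type*} (ξ : n → E) :
    IsSelfAdjoint (E.gram ξ) := by
  ext i j; exact E.form.star_ip _ _

lemma HilbMod.gram_sum (E : HilbMod.{w₁} A) {n : Type*} [Fintype n] (ξ : n → E) (x : n → A) :
    ∑ j, ∑ k, star (x j) * E.gram ξ j k * x k =
      E.form.ip (∑ i, E.rsmul (ξ i) (x i)) (∑ i, E.rsmul (ξ i) (x i)) := by
  have hrs : ∀ (x y : E) (b : A), E.form.ip (E.form.rsmul b x) y = star b * E.form.ip x y :=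
    fun x y b => E.form.ip_rsmul_left x y b
  unfold HilbMod.rsmul
  simp only [map_sum, LinearMap.sum_apply, E.form.ip_rsmul, hrs]
  rw [Finset.sum_comm]
  rfl

end Positivity

namespace Corr

/-- The form `⟨ξ ⊗ η, ξ' ⊗ η'⟩ = ⟨η, ⟨ξ, ξ'⟩ ▷ η'⟩` on the algebraic tensor product. -/
noncomputable def tensorIp (E : HilbMod.{w₁} A) (F : Corr.{w₂} A B) :
    (E ⊗[ℂ] F) →ₗ⋆[ℂ] (E ⊗[ℂ] F) →ₗ[ℂ] B :=
  TensorProduct.lift (LinearMap.mk₂'ₛₗ (starRingEnd ℂ) (starRingEnd ℂ)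
    (fun ξ η => TensorProduct.lift (LinearMap.mk₂ ℂ
      (fun ξ' η' => F.form.ip η (F.lact (E.form.ip ξ ξ') η'))
      (fun _ _ _ => by simp) (fun _ _ _ => by simp) (fun _ _ _ => by simp) (fun _ _ _ => by simp)))
    (fun _ _ _ => by ext; simp) (fun _ _ _ => by ext; simp) (fun _ _ _ => by ext; simp)
    (fun _ _ _ => by ext; simp))

lemma tensorIp_tmul (E : HilbMod.{w₁} A) (F : Corr.{w₂} A B) (ξ ξ' : E) (η η' : F) :
    tensorIp E F (ξ ⊗ₜ η) (ξ' ⊗ₜ η') = F.form.ip η (F.lact (E.form.ip ξ ξ') η') := rfl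

lemma exists_eq_sum_tmul (E : HilbMod.{w₁} A) (F : Corr.{w₂} A B) (z : E ⊗[ℂ] F) :
    ∃ (S : Finset (E × F)) (ξ : S → E) (η : S → F), z = ∑ i, ξ i ⊗ₜ η i := by
  obtain ⟨S, rfl⟩ := TensorProduct.exists_finset z
  exact ⟨S, fun i => i.1.1, fun i => i.1.2, (Finset.sum_coe_sort S fun i => i.1 ⊗ₜ i.2).symm⟩

lemma tensorIp_sum (E : HilbMod.{w₁} A) (F : Corr.{w₂} A B) {n : Type*} [Fintype n]
    (ξ : n → E) (η : n → F) :
    tensorIp E F (∑ i, ξ i ⊗ₜ η i) (∑ i, ξ i ⊗ₜ η i) =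
      ∑ i, ∑ j, F.form.ip (η i) (F.lact (E.gram ξ i j) (η j)) := by
  simp only [map_sum, LinearMap.sum_apply, tensorIp_tmul]
  rw [Finset.sum_comm]
  rfl

lemma tensorIp_self_nonneg (E : HilbMod.{w₁} A) (F : Corr.{w₂} A B) (z : E ⊗[ℂ] F) :
    0 ≤ tensorIp E F z z := by
  classical
  obtain ⟨S, ξ, η, rfl⟩ := exists_eq_sum_tmul E F z
  rw [tensorIp_sum]
  exact F.sum_nonneg _ (E.gram_isSelfAdjoint ξ)
    (fun x => by rw [E.gram_sum]; exact E.form.ip_self_nonneg _) η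

lemma tensorIp_map_left_le {E : HilbMod.{w₁} A} {E' : HilbMod.{w₃} A} (F : Corr.{w₂} A B)
    (T : E →L[ℂ] E') (hT : ∀ (x : E) (a : A), T (E.rsmul x a) = E'.rsmul (T x) a)
    (z : E ⊗[ℂ] F) :
    tensorIp E' F (TensorProduct.map T.toLinearMap LinearMap.id z)
        (TensorProduct.map T.toLinearMap LinearMap.id z) ≤
      ((‖T‖ : ℂ) ^ 2) • tensorIp E F z z := by
  classical
  obtain ⟨S, ξ, η, rfl⟩ := exists_eq_sum_tmul E F z
  have h1 : TensorProduct.map T.toLinearMap LinearMap.id (∑ i, ξ i ⊗ₜ[ℂ] η i) =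
      ∑ i, T (ξ i) ⊗ₜ[ℂ] η i := by
    simp only [map_sum, TensorProduct.map_tmul]
    rfl
  rw [h1, tensorIp_sum, tensorIp_sum, ← sub_nonneg]
  have h2 := F.sum_nonneg (((‖T‖ : ℂ) ^ 2) • E.gram ξ - E'.gram fun i => T (ξ i))
    (IsSelfAdjoint.sub (by
      rw [← Complex.ofReal_pow]
      exact IsSelfAdjoint.smul (Complex.conj_ofReal _) (E.gram_isSelfAdjoint ξ))
      (E'.gram_isSelfAdjoint _)) (fun x => by
        have h3 : ∀ j k, (((‖T‖ : ℂ) ^ 2) • E.gram ξ - E'.gram fun i => T (ξ i)) j k =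
          ((‖T‖ : ℂ) ^ 2) • E.gram ξ j k - E'.gram (fun i => T (ξ i)) j k := fun j k => rfl
        simp only [h3, mul_sub, sub_mul, mul_smul_comm, smul_mul_assoc, Finset.sum_sub_distrib,
          ← Finset.smul_sum]
        rw [E.gram_sum, E'.gram_sum, sub_nonneg]
        have h4 : ∑ i, E'.rsmul (T (ξ i)) (x i) = T (∑ i, E.rsmul (ξ i) (x i)) := by
          simp only [map_sum, hT]
        rw [h4]
        exact HilbMod.ip_map_le T hT _) η
  convert h2 using 1
  have h3 : ∀ j k, (((‖T‖ : ℂ) ^ 2) • E.gram ξ - E'.gram fun i => T (ξ i)) j k =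
    ((‖T‖ : ℂ) ^ 2) • E.gram ξ j k - E'.gram (fun i => T (ξ i)) j k := fun j k => rfl
  simp only [h3, map_sub, map_smul, LinearMap.sub_apply, LinearMap.smul_apply,
    Finset.sum_sub_distrib, ← Finset.smul_sum]

lemma tensorIp_map_right_le (E : HilbMod.{w₁} A) {F : Corr.{w₂} A B} {F' : Corr.{w₃} A B}
    (S : F →L[ℂ] F') (hS : ∀ (x : F) (b : B), S (F.rsmul x b) = F'.rsmul (S x) b)
    (hS' : ∀ (a : A) (x : F), S (F.lact a x) = F'.lact a (S x)) (z : E ⊗[ℂ] F) :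
    tensorIp E F' (TensorProduct.map LinearMap.id S.toLinearMap z)
        (TensorProduct.map LinearMap.id S.toLinearMap z) ≤
      ((‖S‖ : ℂ) ^ 2) • tensorIp E F z z := by
  classical
  obtain ⟨I, ξ, η, rfl⟩ := exists_eq_sum_tmul E F z
  have h1 : TensorProduct.map LinearMap.id S.toLinearMap (∑ i, ξ i ⊗ₜ[ℂ] η i) =
      ∑ i, ξ i ⊗ₜ[ℂ] S (η i) := by
    simp only [map_sum, TensorProduct.map_tmul]
    rfl
  obtain ⟨c, hc⟩ := exists_factor (E.gram ξ) (E.gram_isSelfAdjoint ξ)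
    (fun x => by rw [E.gram_sum]; exact E.form.ip_self_nonneg _)
  rw [h1, tensorIp_sum, tensorIp_sum, hc, F.sum_factor, F'.sum_factor, Finset.smul_sum]
  refine Finset.sum_le_sum fun k _ => ?_
  have h2 : ∑ i, F'.lact (c k i) (S (η i)) = S (∑ i, F.lact (c k i) (η i)) := by
    simp only [map_sum, hS']
  rw [h2]
  exact HilbMod.ip_map_le (E := F.toHilbMod) (E' := F'.toHilbMod) S hS _

/-- The semi-inner product on the algebraic tensor product whose completion is the interior tensor
product. -/
noncomputable def tensorForm (E : HilbMod.{w₁} A) (F : Corr.{w₂} A B) :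
    SemiInner B (E ⊗[ℂ] F) where
  ip := tensorIp E F
  rsmul b := TensorProduct.map LinearMap.id (F.form.rsmul b)
  star_ip x y := by
    induction x using TensorProduct.induction_on with
    | zero => simp
    | add x x' hx hx' => simp [hx, hx']
    | tmul ξ η =>
      induction y using TensorProduct.induction_on with
      | zero => simp
      | add y y' hy hy' => simp [hy, hy']
      | tmul ξ' η' =>
        rw [tensorIp_tmul, tensorIp_tmul, F.form.star_ip, F.ip_lact, E.form.star_ip]
  ip_self_nonneg := tensorIp_self_nonneg E F
  ip_rsmul x y b := by
    induction x using TensorProduct.induction_on with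
    | zero => simp
    | add x x' hx hx' => simp [hx, hx', add_mul]
    | tmul ξ η =>
      induction y using TensorProduct.induction_on with
      | zero => simp
      | add y y' hy hy' => simp [hy, hy', add_mul]
      | tmul ξ' η' =>
        rw [TensorProduct.map_tmul, LinearMap.id_apply, tensorIp_tmul, tensorIp_tmul,
          ← star_star (E.form.ip ξ ξ'), ← F.ip_lact, ← F.ip_lact, F.form.ip_rsmul]

/-- The interior tensor product `E ⊗_A F` as a Hilbert `B`-module: the Hausdorff completion of the
algebraic tensor product. -/
noncomputable def tensorH (E : HilbMod.{w₁} A) (F : Corr.{w₂} A B) : HilbMod.{max w₁ w₂} B :=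
  (tensorForm E F).completion

/-- The canonical map from the algebraic tensor product to the interior tensor product. -/
noncomputable def toTensor (E : HilbMod.{w₁} A) (F : Corr.{w₂} A B) :
    (E ⊗[ℂ] F) →ₗ[ℂ] tensorH E F :=
  (tensorForm E F).ι


section LeftAction

variable (E : Corr.{w₁} A B) (F : Corr.{w₂} B C)

/-- The left action extended to the unitization of `A`. -/
noncomputable def ulact : Unitization ℂ A →ₐ[ℂ] Module.End ℂ E := Unitization.lift E.lact

lemma ip_ulact (u : Unitization ℂ A) (x y : E) :
    E.form.ip (ulact E u x) y = E.form.ip x (ulact E (star u) y) := by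
  induction u using Unitization.ind with
  | inl_add_inr r a =>
    simp [ulact, E.ip_lact]

lemma tensorIp_map_ulact (u : Unitization ℂ A) (z w : E ⊗[ℂ] F) :
    tensorIp E.toHilbMod F (TensorProduct.map (ulact E u) LinearMap.id z) w =
      tensorIp E.toHilbMod F z (TensorProduct.map (ulact E (star u)) LinearMap.id w) := by
  induction z using TensorProduct.induction_on with
  | zero => simp
  | add x x' hx hx' => simp only [map_add, LinearMap.add_apply, hx, hx']
  | tmul ξ η =>
    induction w using TensorProduct.induction_on with
    | zero => simp
    | add y y' hy hy' => simp only [map_add, hy, hy']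
    | tmul ξ' η' =>
      rw [TensorProduct.map_tmul, TensorProduct.map_tmul, tensorIp_tmul, tensorIp_tmul, ip_ulact]
      rfl

lemma exists_bound_ulact (u : Unitization ℂ A) : ∃ K : ℝ, ∀ z : E ⊗[ℂ] F,
    (tensorForm E.toHilbMod F).snorm (TensorProduct.map (ulact E u) LinearMap.id z) ≤
      K * (tensorForm E.toHilbMod F).snorm z := by
  have hu : u ∈ Submodule.span ℂ (unitary (Unitization ℂ A) : Set (Unitization ℂ A)) := by
    rw [CStarAlgebra.span_unitary]; trivial
  induction hu using Submodule.span_induction with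
  | mem u hu =>
    refine ⟨1, fun z => ?_⟩
    rw [one_mul]
    unfold SemiInner.snorm
    change √‖tensorIp E.toHilbMod F _ _‖ ≤ √‖tensorIp E.toHilbMod F _ _‖
    rw [tensorIp_map_ulact, ← LinearMap.comp_apply (TensorProduct.map _ _), ← TensorProduct.map_comp,
      ← Module.End.mul_eq_comp, ← map_mul, (Unitary.mem_iff.1 hu).1, map_one]
    simp [Module.End.one_eq_id]
  | zero => exact ⟨0, fun z => by simp [SemiInner.snorm]⟩
  | add u v _ _ hu hv =>
    obtain ⟨K, hK⟩ := hu
    obtain ⟨K', hK'⟩ := hv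
    refine ⟨K + K', fun z => ?_⟩
    rw [map_add, TensorProduct.map_add_left, LinearMap.add_apply, add_mul]
    exact (SemiInner.snorm_add_le _ _ _).trans (add_le_add (hK z) (hK' z))
  | smul c u _ hu =>
    obtain ⟨K, hK⟩ := hu
    refine ⟨‖c‖ * K, fun z => ?_⟩
    rw [map_smul, TensorProduct.map_smul_left, LinearMap.smul_apply, SemiInner.snorm_smul, mul_assoc]
    gcongr
    exact hK z

/-- The algebraic left action `a ▷ (ξ ⊗ η) = (a ▷ ξ) ⊗ η`. -/
noncomputable def algLact (a : A) : (E ⊗[ℂ] F) →ₗ[ℂ] (E ⊗[ℂ] F) :=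
  TensorProduct.map (E.lact a) LinearMap.id

lemma exists_bound_algLact (a : A) : ∃ K : ℝ, ∀ z : E ⊗[ℂ] F,
    (tensorForm E.toHilbMod F).snorm (algLact E F a z) ≤
      K * (tensorForm E.toHilbMod F).snorm z := by
  have h := exists_bound_ulact E F (a : Unitization ℂ A)
  have h2 : ulact E (a : Unitization ℂ A) = E.lact a := by simp [ulact]
  rwa [h2] at h

/-- The left action on the interior tensor product, by continuous extension. -/
noncomputable def tensorLact (a : A) : tensorH E.toHilbMod F →L[ℂ] tensorH E.toHilbMod F :=
  (toTensor E.toHilbMod F ∘ₗ algLact E F a).extendOfNorm (toTensor E.toHilbMod F)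

lemma denseRange_toTensor (E : HilbMod.{w₁} A) (F : Corr.{w₂} A B) : DenseRange (toTensor E F) :=
  (tensorForm E F).denseRange_ι

lemma tensorLact_toTensor (a : A) (z : E ⊗[ℂ] F) :
    tensorLact E F a (toTensor E.toHilbMod F z) = toTensor E.toHilbMod F (algLact E F a z) := by
  obtain ⟨K, hK⟩ := exists_bound_algLact E F a
  refine LinearMap.extendOfNorm_eq (denseRange_toTensor _ _) ⟨K, fun x => ?_⟩ z
  have h1 := (tensorForm E.toHilbMod F).norm_ι x
  have h2 := (tensorForm E.toHilbMod F).norm_ι (algLact E F a x)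
  have h3 := hK x
  rw [← h1, ← h2] at h3
  exact h3

lemma tensorH_induction {E : HilbMod.{w₁} A} {F : Corr.{w₂} A B} {p : tensorH E F → Prop}
    (hp : IsClosed {x | p x}) (h : ∀ z, p (toTensor E F z)) (x : tensorH E F) : p x :=
  (denseRange_toTensor E F).induction_on x hp h

lemma tensorH_ip (E : HilbMod.{w₁} A) (F : Corr.{w₂} A B) (z w : E ⊗[ℂ] F) :
    (tensorH E F).form.ip (toTensor E F z) (toTensor E F w) = tensorIp E F z w :=
  (tensorForm E F).complIp_ι z w

lemma tensorH_continuous_ip (E : HilbMod.{w₁} A) (F : Corr.{w₂} A B) {X : Type*}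
    [TopologicalSpace X] {f g : X → tensorH E F} (hf : Continuous f) (hg : Continuous g) :
    Continuous fun x => (tensorH E F).form.ip (f x) (g x) :=
  (tensorForm E F).continuous_complIp' hf hg

lemma tensorH_ext {E : HilbMod.{w₁} A} {F : Corr.{w₂} A B} {G : Type*} [NormedAddCommGroup G]
    [NormedSpace ℂ G] {f g : tensorH E F →L[ℂ] G}
    (h : ∀ z, f (toTensor E F z) = g (toTensor E F z)) : f = g :=
  ContinuousLinearMap.ext fun x =>
    tensorH_induction (p := fun x => f x = g x) (isClosed_eq f.continuous g.continuous) h x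

lemma tensorLact_smul (c : ℂ) (a : A) : tensorLact E F (c • a) = c • tensorLact E F a :=
  tensorH_ext fun z => by
    simp only [tensorLact_toTensor, algLact, map_smul, TensorProduct.map_smul_left,
      LinearMap.smul_apply, smul_apply]

lemma tensorLact_add (a b : A) : tensorLact E F (a + b) = tensorLact E F a + tensorLact E F b :=
  tensorH_ext fun z => by
    simp only [tensorLact_toTensor, algLact, map_add, TensorProduct.map_add_left,
      LinearMap.add_apply, add_apply]

lemma tensorLact_mul (a b : A) :
    tensorLact E F (a * b) = (tensorLact E F a).comp (tensorLact E F b) :=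
  tensorH_ext fun z => by
    simp only [tensorLact_toTensor, algLact, ContinuousLinearMap.comp_apply]
    rw [map_mul, Module.End.mul_eq_comp, ← LinearMap.comp_apply (TensorProduct.map _ _),
      ← TensorProduct.map_comp, LinearMap.comp_id]

/-- The interior tensor product `E ⊗_B F` of correspondences. -/
noncomputable def tensor : Corr.{max w₁ w₂} A C where
  toHilbMod := tensorH E.toHilbMod F
  lact :=
    { toFun := fun a => (tensorLact E F a).toLinearMap
      map_smul' := fun c a => by rw [tensorLact_smul]; rfl
      map_zero' := by
        have h := tensorLact_smul E F 0 0
        rw [zero_smul, zero_smul] at h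
        rw [h]; rfl
      map_add' := fun a b => by rw [tensorLact_add]; rfl
      map_mul' := fun a b => by rw [tensorLact_mul]; rfl }
  ip_lact a x y := by
    change (tensorH E.toHilbMod F).form.ip (tensorLact E F a x) y =
      (tensorH E.toHilbMod F).form.ip x (tensorLact E F (star a) y)
    refine tensorH_induction (p := fun x => (tensorH E.toHilbMod F).form.ip (tensorLact E F a x) y =
      (tensorH E.toHilbMod F).form.ip x (tensorLact E F (star a) y))
      (isClosed_eq (tensorH_continuous_ip _ _ (by fun_prop) (by fun_prop))
        (tensorH_continuous_ip _ _ (by fun_prop) (by fun_prop))) (fun z => ?_) x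
    refine tensorH_induction (p := fun y => (tensorH E.toHilbMod F).form.ip
        (tensorLact E F a (toTensor E.toHilbMod F z)) y =
      (tensorH E.toHilbMod F).form.ip (toTensor E.toHilbMod F z) (tensorLact E F (star a) y))
      (isClosed_eq (tensorH_continuous_ip _ _ (by fun_prop) (by fun_prop))
        (tensorH_continuous_ip _ _ (by fun_prop) (by fun_prop))) (fun w => ?_) y
    simp only [tensorLact_toTensor, tensorH_ip]
    have h := tensorIp_map_ulact E F (a : Unitization ℂ A) z w
    simpa [ulact, algLact] using h

end LeftAction


section Maps

lemma self_ip_lact (A : Type uA) [NonUnitalCStarAlgebra A] (a x y : A) :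
    star (a * x) * y = star x * (star a * y) := by
  rw [star_mul, mul_assoc]

lemma ofHom_ip_lact (φ : A →⋆ₙₐ[ℂ] 𝓜(ℂ, B)) (a : A) (x y : B) :
    star ((φ a).fst x) * y = star x * (φ (star a)).fst y := by
  rw [map_star, DoubleCentralizer.star_fst, ← star_star y, ← star_mul, ← star_mul, star_star,
    (φ a).central]

/-- The correspondence `A` over `A`. -/
noncomputable def self (A : Type uA) [NonUnitalCStarAlgebra A] [PartialOrder A]
    [StarOrderedRing A] : Corr.{uA} A A where
  toHilbMod := HilbMod.self A
  lact := NonUnitalAlgHom.lmul ℂ A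
  ip_lact a x y := self_ip_lact A a x y

/-- The canonical map from the algebraic to the interior tensor product. -/
noncomputable def ofAlg (E : Corr.{w₁} A B) (F : Corr.{w₂} B C) : (E ⊗[ℂ] F) →ₗ[ℂ] E.tensor F :=
  toTensor E.toHilbMod F

/-- The elementary tensor `ξ ⊗ η` in `E ⊗_B F`. -/
noncomputable def tmul (E : Corr.{w₁} A B) (F : Corr.{w₂} B C) (ξ : E) (η : F) : E.tensor F :=
  ofAlg E F (ξ ⊗ₜ η)

lemma norm_ofAlg_sq (E : Corr.{w₁} A B) (F : Corr.{w₂} B C) (z : E ⊗[ℂ] F) :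
    ‖ofAlg E F z‖ ^ 2 = ‖tensorIp E.toHilbMod F z z‖ := by
  rw [← tensorH_ip]
  exact (tensorH E.toHilbMod F).norm_sq _

lemma denseRange_ofAlg (E : Corr.{w₁} A B) (F : Corr.{w₂} B C) : DenseRange (ofAlg E F) :=
  denseRange_toTensor E.toHilbMod F

/-- `T ⊗ id : E ⊗ F → E' ⊗ F`, the continuous extension of the algebraic `T ⊗ id` (which exists
whenever `T` is bounded and right linear). -/
noncomputable def rTensor (E : Corr.{w₁} A B) (E' : Corr.{w₂} A B) (F : Corr.{w₃} B C) (T : E →L[ℂ] E') :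
    E.tensor F →L[ℂ] E'.tensor F :=
  (ofAlg E' F ∘ₗ TensorProduct.map T.toLinearMap LinearMap.id).extendOfNorm (ofAlg E F)

lemma rTensor_ofAlg (E : Corr.{w₁} A B) (E' : Corr.{w₂} A B) (F : Corr.{w₃} B C) (T : E →L[ℂ] E')
    (hT : ∀ (x : E) (b : B), T (E.rsmul x b) = E'.rsmul (T x) b) (z : E ⊗[ℂ] F) :
    rTensor E E' F T (ofAlg E F z) =
      ofAlg E' F (TensorProduct.map T.toLinearMap LinearMap.id z) := by
  refine LinearMap.extendOfNorm_eq (denseRange_ofAlg E F) ⟨‖T‖, fun z => ?_⟩ z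
  refine le_of_sq_le_sq ?_ (mul_nonneg (norm_nonneg _) (norm_nonneg _))
  rw [mul_pow, norm_ofAlg_sq, ← norm_smul_sq]
  exact (norm_ofAlg_sq _ _ _).trans_le (CStarAlgebra.norm_le_norm_of_nonneg_of_le
    (tensorIp_self_nonneg _ _ _)
    (tensorIp_map_left_le (E := E.toHilbMod) (E' := E'.toHilbMod) F T hT z))

/-- `id ⊗ S : E ⊗ F → E ⊗ F'`, the continuous extension of the algebraic `id ⊗ S` (which exists
whenever `S` is bounded and bilinear). -/
noncomputable def lTensor (E : Corr.{w₁} A B) (F : Corr.{w₂} B C) (F' : Corr.{w₃} B C)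
    (S : F →L[ℂ] F') : E.tensor F →L[ℂ] E.tensor F' :=
  (ofAlg E F' ∘ₗ TensorProduct.map LinearMap.id S.toLinearMap).extendOfNorm (ofAlg E F)

lemma lTensor_ofAlg (E : Corr.{w₁} A B) (F : Corr.{w₂} B C) (F' : Corr.{w₃} B C) (S : F →L[ℂ] F')
    (hS : ∀ (x : F) (c : C), S (F.rsmul x c) = F'.rsmul (S x) c)
    (hS' : ∀ (b : B) (x : F), S (F.lact b x) = F'.lact b (S x)) (z : E ⊗[ℂ] F) :
    lTensor E F F' S (ofAlg E F z) =
      ofAlg E F' (TensorProduct.map LinearMap.id S.toLinearMap z) := by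
  refine LinearMap.extendOfNorm_eq (denseRange_ofAlg E F) ⟨‖S‖, fun z => ?_⟩ z
  refine le_of_sq_le_sq ?_ (mul_nonneg (norm_nonneg _) (norm_nonneg _))
  rw [mul_pow, norm_ofAlg_sq, ← norm_smul_sq]
  exact (norm_ofAlg_sq _ _ _).trans_le (CStarAlgebra.norm_le_norm_of_nonneg_of_le
    (tensorIp_self_nonneg _ _ _) (tensorIp_map_right_le E.toHilbMod S hS hS' z))

/-- The canonical map from the algebraic triple tensor product to `(E ⊗ F) ⊗ G`. -/
noncomputable def ofAlgLeft (E : Corr.{w₁} A B) (F : Corr.{w₂} B C) (G : Corr.{w₃} C D) :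
    ((E ⊗[ℂ] F) ⊗[ℂ] G) →ₗ[ℂ] (E.tensor F).tensor G :=
  ofAlg (E.tensor F) G ∘ₗ TensorProduct.map (ofAlg E F) LinearMap.id

/-- The canonical map from the algebraic triple tensor product to `E ⊗ (F ⊗ G)`. -/
noncomputable def ofAlgRight (E : Corr.{w₁} A B) (F : Corr.{w₂} B C) (G : Corr.{w₃} C D) :
    ((E ⊗[ℂ] F) ⊗[ℂ] G) →ₗ[ℂ] E.tensor (F.tensor G) :=
  ofAlg E (F.tensor G) ∘ₗ TensorProduct.map LinearMap.id (ofAlg F G) ∘ₗ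
    (TensorProduct.assoc ℂ E F G).toLinearMap

/-- The associativity unitary `(E ⊗ F) ⊗ G → E ⊗ (F ⊗ G)`, `(ξ ⊗ η) ⊗ ζ ↦ ξ ⊗ (η ⊗ ζ)`. -/
noncomputable def assoc (E : Corr.{w₁} A B) (F : Corr.{w₂} B C) (G : Corr.{w₃} C D) :
    (E.tensor F).tensor G →L[ℂ] E.tensor (F.tensor G) :=
  (ofAlgRight E F G).extendOfNorm (ofAlgLeft E F G)

/-- The inverse associativity unitary `ξ ⊗ (η ⊗ ζ) ↦ (ξ ⊗ η) ⊗ ζ`. -/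
noncomputable def assocInv (E : Corr.{w₁} A B) (F : Corr.{w₂} B C) (G : Corr.{w₃} C D) :
    E.tensor (F.tensor G) →L[ℂ] (E.tensor F).tensor G :=
  (ofAlgLeft E F G).extendOfNorm (ofAlgRight E F G)

lemma ip_ofAlgLeft (E : Corr.{w₁} A B) (F : Corr.{w₂} B C) (G : Corr.{w₃} C D)
    (x y : (E ⊗[ℂ] F) ⊗[ℂ] G) :
    tensorIp (E.tensor F).toHilbMod G (TensorProduct.map (ofAlg E F) LinearMap.id x)
        (TensorProduct.map (ofAlg E F) LinearMap.id y) =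
      tensorIp E.toHilbMod (F.tensor G)
        (TensorProduct.map LinearMap.id (ofAlg F G) (TensorProduct.assoc ℂ E F G x))
        (TensorProduct.map LinearMap.id (ofAlg F G) (TensorProduct.assoc ℂ E F G y)) := by
  induction x using TensorProduct.induction_on with
  | zero => simp
  | add x x' hx hx' => simp only [map_add, LinearMap.add_apply, hx, hx']
  | tmul x ζ =>
    induction y using TensorProduct.induction_on with
    | zero => simp
    | add y y' hy hy' => simp only [map_add, hy, hy']
    | tmul y ζ' =>
      induction x using TensorProduct.induction_on with
      | zero => simp
      | add x x' hx hx' =>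
        simp only [map_add, LinearMap.add_apply, hx, hx', TensorProduct.add_tmul]
      | tmul ξ η =>
        induction y using TensorProduct.induction_on with
        | zero => simp
        | add y y' hy hy' => simp only [map_add, hy, hy', TensorProduct.add_tmul]
        | tmul ξ' η' =>
          simp only [TensorProduct.map_tmul, TensorProduct.assoc_tmul, tensorIp_tmul,
            LinearMap.id_apply]
          have h1 : (E.tensor F).form.ip (ofAlg E F (ξ ⊗ₜ η)) (ofAlg E F (ξ' ⊗ₜ η')) =
              F.form.ip η (F.lact (E.form.ip ξ ξ') η') := tensorH_ip E.toHilbMod F _ _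
          have h2 : (F.tensor G).lact (E.form.ip ξ ξ') (ofAlg F G (η' ⊗ₜ ζ')) =
              ofAlg F G (F.lact (E.form.ip ξ ξ') η' ⊗ₜ ζ') := tensorLact_toTensor F G _ _
          have h3 : ∀ z w, (F.tensor G).form.ip (ofAlg F G z) (ofAlg F G w) =
              tensorIp F.toHilbMod G z w := tensorH_ip F.toHilbMod G
          rw [h1, h2, h3, tensorIp_tmul]

lemma norm_ofAlgLeft (E : Corr.{w₁} A B) (F : Corr.{w₂} B C) (G : Corr.{w₃} C D)
    (x : (E ⊗[ℂ] F) ⊗[ℂ] G) : ‖ofAlgLeft E F G x‖ = ‖ofAlgRight E F G x‖ := by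
  refine (sq_eq_sq₀ (norm_nonneg _) (norm_nonneg _)).1 ?_
  have h1 := norm_ofAlg_sq (E.tensor F) G (TensorProduct.map (ofAlg E F) LinearMap.id x)
  have h2 := norm_ofAlg_sq E (F.tensor G)
    (TensorProduct.map LinearMap.id (ofAlg F G) (TensorProduct.assoc ℂ E F G x))
  rw [ip_ofAlgLeft, ← h2] at h1
  exact h1

lemma norm_lact_le (E : Corr.{w₁} A B) (a : A) (x : E) : ‖E.lact a x‖ ≤ ‖a‖ * ‖x‖ := by
  have h1 := CStarAlgebra.star_mul_le_algebraMap_norm_sq (a := (a : Unitization ℂ A))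
  rw [← sub_nonneg, CStarAlgebra.nonneg_iff_eq_star_mul_self] at h1
  obtain ⟨c, hc⟩ := h1
  have h2 : E.form.ip (ulact E c x) (ulact E c x) =
      ((‖a‖ : ℂ) ^ 2) • E.form.ip x x - E.form.ip (E.lact a x) (E.lact a x) := by
    have h3 : ulact E (a : Unitization ℂ A) = E.lact a := by simp [ulact]
    have h4 : algebraMap ℝ (Unitization ℂ A) (‖(a : Unitization ℂ A)‖ ^ 2) =
        algebraMap ℂ (Unitization ℂ A) ((‖a‖ : ℂ) ^ 2) := by
      rw [Unitization.norm_inr, IsScalarTower.algebraMap_apply ℝ ℂ]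
      simp
    rw [ip_ulact, ← Module.End.mul_apply, ← map_mul, ← hc, h4, map_sub, map_mul, AlgHom.commutes,
      LinearMap.sub_apply, map_sub, Module.End.mul_apply, ← ip_ulact, h3,
      Module.algebraMap_end_apply, map_smul]
  have h5 : E.form.ip (E.lact a x) (E.lact a x) ≤ ((‖a‖ : ℂ) ^ 2) • E.form.ip x x :=
    sub_nonneg.1 (h2 ▸ E.form.ip_self_nonneg _)
  refine le_of_sq_le_sq ?_ (mul_nonneg (norm_nonneg _) (norm_nonneg _))
  rw [mul_pow, E.norm_sq, E.norm_sq, ← norm_smul_sq]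
  exact CStarAlgebra.norm_le_norm_of_nonneg_of_le (E.form.ip_self_nonneg _) h5

lemma norm_ip_le (E : HilbMod.{w₁} B) (x y : E) : ‖E.form.ip x y‖ ≤ ‖x‖ * ‖y‖ := by
  have h : ∀ z : E, E.form.snorm z = ‖z‖ := fun z => by
    rw [SemiInner.snorm, ← E.norm_sq, Real.sqrt_sq (norm_nonneg _)]
  simpa only [h] using E.form.norm_ip_le x y

lemma norm_tmul_le (E : Corr.{w₁} A B) (F : Corr.{w₂} B C) (x : E) (y : F) :
    ‖tmul E F x y‖ ≤ ‖x‖ * ‖y‖ := by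
  refine le_of_sq_le_sq ?_ (mul_nonneg (norm_nonneg _) (norm_nonneg _))
  refine (norm_ofAlg_sq E F (x ⊗ₜ y)).trans_le ?_
  rw [tensorIp_tmul]
  calc _ ≤ ‖y‖ * (‖E.form.ip x x‖ * ‖y‖) := (norm_ip_le F.toHilbMod _ _).trans
        (mul_le_mul_of_nonneg_left (norm_lact_le F _ _) (norm_nonneg _))
    _ = (‖x‖ * ‖y‖) ^ 2 := by rw [← E.norm_sq]; ring

/-- `tmul` as a continuous bilinear map. -/
noncomputable def tmulL (E : Corr.{w₁} A B) (F : Corr.{w₂} B C) : E →L[ℂ] F →L[ℂ] E.tensor F :=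
  LinearMap.mkContinuous₂ ((TensorProduct.mk ℂ E F).compr₂ (ofAlg E F)) 1 fun x y => by
    rw [one_mul]; exact norm_tmul_le E F x y

lemma denseRange_aux {V E F : Type*} [AddCommGroup V] [Module ℂ V] [NormedAddCommGroup E]
    [NormedSpace ℂ E] (f : F → E) (g : V →ₗ[ℂ] E) (hf : Dense (Submodule.span ℂ (Set.range f) : Set E))
    (h : ∀ x, f x ∈ closure (Set.range g)) : DenseRange g := by
  have h1 : Submodule.span ℂ (Set.range f) ≤ (LinearMap.range g).topologicalClosure := by
    rw [Submodule.span_le]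
    rintro _ ⟨x, rfl⟩
    exact h x
  have h2 : closure (Submodule.span ℂ (Set.range f) : Set E) ⊆ closure (Set.range g) :=
    closure_minimal h1 isClosed_closure
  exact fun x => h2 (hf x)

lemma dense_span_tmul (E : Corr.{w₁} A B) (F : Corr.{w₂} B C) :
    Dense (Submodule.span ℂ (Set.range fun p : E × F => tmul E F p.1 p.2) :
      Set (E.tensor F)) := by
  refine (denseRange_ofAlg E F).mono ?_
  rintro _ ⟨z, rfl⟩
  induction z using TensorProduct.induction_on with
  | zero => rw [map_zero]; exact Submodule.zero_mem _
  | add x y hx hy => rw [map_add]; exact Submodule.add_mem _ hx hy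
  | tmul x y => exact Submodule.subset_span ⟨(x, y), rfl⟩

lemma denseRange_ofAlgLeft (E : Corr.{w₁} A B) (F : Corr.{w₂} B C) (G : Corr.{w₃} C D) :
    DenseRange (ofAlgLeft E F G) := by
  refine denseRange_aux _ _ (dense_span_tmul (E.tensor F) G) fun ⟨z, ζ⟩ => ?_
  refine (denseRange_ofAlg E F).induction_on (p := fun z => tmul (E.tensor F) G z ζ ∈ _) z
    (isClosed_closure.preimage (((tmulL (E.tensor F) G).flip ζ).continuous)) fun t => ?_
  exact subset_closure ⟨t ⊗ₜ ζ, rfl⟩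

lemma denseRange_ofAlgRight (E : Corr.{w₁} A B) (F : Corr.{w₂} B C) (G : Corr.{w₃} C D) :
    DenseRange (ofAlgRight E F G) := by
  refine denseRange_aux _ _ (dense_span_tmul E (F.tensor G)) fun ⟨x, w⟩ => ?_
  refine (denseRange_ofAlg F G).induction_on (p := fun w => tmul E (F.tensor G) x w ∈ _) w
    (isClosed_closure.preimage ((tmulL E (F.tensor G) x).continuous)) fun t => ?_
  refine subset_closure ⟨(TensorProduct.assoc ℂ E F G).symm (x ⊗ₜ t), ?_⟩
  simp [ofAlgRight, tmul]

lemma assoc_ofAlgLeft (E : Corr.{w₁} A B) (F : Corr.{w₂} B C) (G : Corr.{w₃} C D)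
    (x : (E ⊗[ℂ] F) ⊗[ℂ] G) : assoc E F G (ofAlgLeft E F G x) = ofAlgRight E F G x :=
  LinearMap.extendOfNorm_eq (denseRange_ofAlgLeft E F G)
    ⟨1, fun x => by rw [one_mul, norm_ofAlgLeft]⟩ x

lemma assocInv_ofAlgRight (E : Corr.{w₁} A B) (F : Corr.{w₂} B C) (G : Corr.{w₃} C D)
    (x : (E ⊗[ℂ] F) ⊗[ℂ] G) : assocInv E F G (ofAlgRight E F G x) = ofAlgLeft E F G x :=
  LinearMap.extendOfNorm_eq (denseRange_ofAlgRight E F G)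
    ⟨1, fun x => by rw [one_mul, norm_ofAlgLeft]⟩ x

/-- The map `A ⊙ E → E`, `a ⊗ ξ ↦ a ▷ ξ`. -/
noncomputable def mulMap (E : Corr.{w₁} A B) : (self A ⊗[ℂ] E) →ₗ[ℂ] E :=
  TensorProduct.lift (show A →ₗ[ℂ] E →ₗ[ℂ] E from (E.lact : A →ₗ[ℂ] Module.End ℂ E))

lemma mulMap_ip_aux (E : Corr.{w₁} A B) (a a' : A) (ξ ξ' : E) :
    E.form.ip (E.lact a ξ) (E.lact a' ξ') = E.form.ip ξ (E.lact (star a * a') ξ') := by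
  rw [E.ip_lact, map_mul, Module.End.mul_apply]

/-- The unitary `l_E : E → A ⊗ E`, `a ▷ ξ ↦ a ⊗ ξ`, for a nondegenerate `E`. -/
noncomputable def lUnit (E : Corr.{w₁} A B) : E →L[ℂ] (self A).tensor E :=
  (ofAlg (self A) E).extendOfNorm (mulMap E)

lemma norm_mulMap (E : Corr.{w₁} A B) (z : self A ⊗[ℂ] E) :
    ‖mulMap E z‖ = ‖ofAlg (self A) E z‖ := by
  refine (sq_eq_sq₀ (norm_nonneg _) (norm_nonneg _)).1 ?_
  rw [norm_ofAlg_sq, E.norm_sq]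
  congr 1
  have h : ∀ z w, E.form.ip (mulMap E z) (mulMap E w) = tensorIp (self A).toHilbMod E z w := by
    intro z w
    induction z using TensorProduct.induction_on with
    | zero => simp
    | add x x' hx hx' => simp only [map_add, LinearMap.add_apply, hx, hx']
    | tmul a ξ =>
      induction w using TensorProduct.induction_on with
      | zero => simp
      | add y y' hy hy' => simp only [map_add, hy, hy']
      | tmul a' ξ' => exact mulMap_ip_aux E a a' ξ ξ'
  exact h z z

lemma lUnit_mulMap (E : Corr.{w₁} A B) (hE : E.Nondegenerate) (z : self A ⊗[ℂ] E) :
    lUnit E (mulMap E z) = ofAlg (self A) E z := by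
  refine LinearMap.extendOfNorm_eq ?_ ⟨1, fun x => by rw [one_mul, norm_mulMap]⟩ z
  refine hE.mono ?_
  rw [← LinearMap.coe_range, SetLike.coe_subset_coe, Submodule.span_le]
  rintro _ ⟨a, x, rfl⟩
  exact ⟨(show self A from a) ⊗ₜ x, rfl⟩

/-- The adjoint of `l_E`, i.e. `A ⊗ E → E`, `a ⊗ ξ ↦ a ▷ ξ`. -/
noncomputable def lUnitAdj (E : Corr.{w₁} A B) : (self A).tensor E →L[ℂ] E :=
  (mulMap E).extendOfNorm (ofAlg (self A) E)

lemma lUnitAdj_ofAlg (E : Corr.{w₁} A B) (z : self A ⊗[ℂ] E) :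
    lUnitAdj E (ofAlg (self A) E z) = mulMap E z :=
  LinearMap.extendOfNorm_eq (denseRange_ofAlg _ _) ⟨1, fun x => by rw [one_mul, norm_mulMap]⟩ z

/-- A multiplier of `A` as an operator on the Hilbert module `A`. -/
noncomputable def mulOp (h : 𝓜(ℂ, A)) : self A →L[ℂ] self A :=
  (show A →L[ℂ] A from h.fst)

/-- The left action of `M(A)` on a nondegenerate `E`: `h ▷ ξ = l_E⋆ (h ⊗ id) l_E ξ`. -/
noncomputable def multAct (E : Corr.{w₁} A B) (h : 𝓜(ℂ, A)) (ξ : E) : E :=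
  lUnitAdj E (rTensor (self A) (self A) E (mulOp h) (lUnit E ξ))

/-- The correspondence `_φ B` of a `*`-homomorphism `φ : A → M(B)`: the Hilbert module `B` with
left action `a ▷ b = φ(a) b`. -/
noncomputable def ofHom (φ : A →⋆ₙₐ[ℂ] 𝓜(ℂ, B)) : Corr.{uB} A B where
  toHilbMod := HilbMod.self B
  lact :=
    { toFun := fun a => (mulOp (φ a)).toLinearMap
      map_smul' := fun c a => by rw [map_smul]; rfl
      map_zero' := by rw [map_zero]; rfl
      map_add' := fun a b => by rw [map_add]; rfl
      map_mul' := fun a b => by rw [map_mul]; rfl }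
  ip_lact a x y := ofHom_ip_lact φ a x y

/-- The unitary `l_E` for a nondegenerate `B`-`C`-correspondence `E`, with its target regarded as
the `A`-`C`-correspondence `_φ B ⊗ E` (which is `B ⊗ E` as a Hilbert `C`-module). -/
noncomputable def lUnitHom (φ : A →⋆ₙₐ[ℂ] 𝓜(ℂ, B)) (E : Corr.{w₁} B C) :
    E →L[ℂ] (ofHom φ).tensor E :=
  lUnit E

end Maps

end Corr

section Adjointable

/-- The space `L(E, F)` of adjointable operators between Hilbert `B`-modules. -/
def Adj (E : HilbMod.{w₁} B) (F : HilbMod.{w₂} B) : Submodule ℂ (E →L[ℂ] F) where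
  carrier := {T | ∃ S : F →L[ℂ] E, ∀ x y, F.ip (T x) y = E.ip x (S y)}
  add_mem' := by
    rintro T T' ⟨S, hS⟩ ⟨S', hS'⟩
    refine ⟨S + S', fun x y => ?_⟩
    have h1 := hS x y
    have h2 := hS' x y
    simp only [HilbMod.ip] at h1 h2 ⊢
    simp [h1, h2]
  zero_mem' := ⟨0, fun x y => by simp [HilbMod.ip]⟩
  smul_mem' := by
    rintro c T ⟨S, hS⟩
    refine ⟨(starRingEnd ℂ c) • S, fun x y => ?_⟩
    have h1 := hS x y
    simp only [HilbMod.ip] at h1 ⊢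
    simp [h1]

/-- The adjoint `T⋆` of `T ∈ L(E, F)`. -/
noncomputable def adjoint {E : HilbMod.{w₁} B} {F : HilbMod.{w₂} B} (T : Adj E F) :
    F →L[ℂ] E := T.2.choose

end Adjointable

end HilbertModules

section Categories

/-- A unitary tensor category: a rigid C⋆-tensor category (with finite direct sums and subobjects)
with simple unit and countably many isomorphism classes of simple objects. Composition is written
in diagrammatic order, so that `f ≫ dag f` is the endomorphism `f⋆ f` of the source of `f`. -/
class UnitaryTensorCategory (𝒞 : Type u) [Category.{v} 𝒞] [Preadditive 𝒞] [Linear ℂ 𝒞]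
    [MonoidalCategory 𝒞] [MonoidalPreadditive 𝒞] [MonoidalLinear ℂ 𝒞] where
  /-- the involution `f ↦ f⋆` -/
  dag : ∀ {X Y : 𝒞}, (X ⟶ Y) → (Y ⟶ X)
  dag_add : ∀ {X Y : 𝒞} (f g : X ⟶ Y), dag (f + g) = dag f + dag g
  dag_smul : ∀ {X Y : 𝒞} (c : ℂ) (f : X ⟶ Y), dag (c • f) = (starRingEnd ℂ c) • dag f
  dag_dag : ∀ {X Y : 𝒞} (f : X ⟶ Y), dag (dag f) = f
  dag_comp : ∀ {X Y Z : 𝒞} (f : X ⟶ Y) (g : Y ⟶ Z), dag (f ≫ g) = dag g ≫ dag f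
  /-- the norm on morphism spaces -/
  hnorm : ∀ {X Y : 𝒞}, (X ⟶ Y) → ℝ
  hnorm_nonneg : ∀ {X Y : 𝒞} (f : X ⟶ Y), 0 ≤ hnorm f
  hnorm_eq_zero : ∀ {X Y : 𝒞} (f : X ⟶ Y), hnorm f = 0 → f = 0
  hnorm_add_le : ∀ {X Y : 𝒞} (f g : X ⟶ Y), hnorm (f + g) ≤ hnorm f + hnorm g
  hnorm_smul : ∀ {X Y : 𝒞} (c : ℂ) (f : X ⟶ Y), hnorm (c • f) = ‖c‖ * hnorm f
  hnorm_comp_le : ∀ {X Y Z : 𝒞} (f : X ⟶ Y) (g : Y ⟶ Z), hnorm (f ≫ g) ≤ hnorm f * hnorm g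
  hnorm_complete : ∀ {X Y : 𝒞} (s : ℕ → (X ⟶ Y)),
    (∀ ε : ℝ, 0 < ε → ∃ N, ∀ m ≥ N, ∀ n ≥ N, hnorm (s m - s n) < ε) →
      ∃ f, ∀ ε : ℝ, 0 < ε → ∃ N, ∀ n ≥ N, hnorm (s n - f) < ε
  /-- the C⋆-identity `‖f⋆ f‖ = ‖f‖²` -/
  hnorm_comp_dag : ∀ {X Y : 𝒞} (f : X ⟶ Y), hnorm (f ≫ dag f) = hnorm f ^ 2
  /-- `f⋆ f` is a positive element of the C⋆-algebra of endomorphisms of `X` -/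
  comp_dag_pos : ∀ {X Y : 𝒞} (f : X ⟶ Y), ∃ g : X ⟶ X, f ≫ dag f = g ≫ dag g
  dag_tensor : ∀ {X Y X' Y' : 𝒞} (f : X ⟶ Y) (g : X' ⟶ Y'), dag (f ⊗ₘ g) = dag f ⊗ₘ dag g
  dag_associator : ∀ X Y Z : 𝒞, dag (α_ X Y Z).hom = (α_ X Y Z).inv
  dag_leftUnitor : ∀ X : 𝒞, dag (λ_ X).hom = (λ_ X).inv
  dag_rightUnitor : ∀ X : 𝒞, dag (ρ_ X).hom = (ρ_ X).inv
  /-- finite direct sums -/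
  exists_sum : ∀ X Y : 𝒞, ∃ (Z : 𝒞) (i : X ⟶ Z) (j : Y ⟶ Z), i ≫ dag i = 𝟙 X ∧ j ≫ dag j = 𝟙 Y ∧
    dag i ≫ i + dag j ≫ j = 𝟙 Z
  /-- subobjects -/
  exists_sub : ∀ (X : 𝒞) (p : X ⟶ X), p ≫ p = p → dag p = p →
    ∃ (Y : 𝒞) (i : Y ⟶ X), i ≫ dag i = 𝟙 Y ∧ dag i ≫ i = p
  /-- the unit is simple -/
  unit_ne_zero : 𝟙 (𝟙_ 𝒞) ≠ 0
  unit_simple : ∀ f : 𝟙_ 𝒞 ⟶ 𝟙_ 𝒞, ∃ c : ℂ, f = c • 𝟙 (𝟙_ 𝒞)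
  /-- every object has a conjugate: `R : 1 → X̄ ⊗ X` and `R' : 1 → X ⊗ X̄` satisfy the conjugate
  equations `(R'⋆ ⊗ id) (id ⊗ R) = id` and `(R⋆ ⊗ id) (id ⊗ R') = id` -/
  exists_conj : ∀ X : 𝒞, ∃ (X' : 𝒞) (R : 𝟙_ 𝒞 ⟶ X' ⊗ X) (R' : 𝟙_ 𝒞 ⟶ X ⊗ X'),
    (ρ_ X).inv ≫ (X ◁ R) ≫ (α_ X X' X).inv ≫ (dag R' ▷ X) ≫ (λ_ X).hom = 𝟙 X ∧
    (ρ_ X').inv ≫ (X' ◁ R') ≫ (α_ X' X X').inv ≫ (dag R ▷ X') ≫ (λ_ X').hom = 𝟙 X'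
  /-- countably many isomorphism classes of simple objects -/
  countable_simple : ∃ S : Set 𝒞, S.Countable ∧ ∀ X : 𝒞, 𝟙 X ≠ 0 →
    (∀ f : X ⟶ X, ∃ c : ℂ, f = c • 𝟙 X) → ∃ Y ∈ S, Nonempty (X ≅ Y)

variable {A : Type uA} [NonUnitalCStarAlgebra A] [PartialOrder A] [StarOrderedRing A]
variable {B : Type uB} [NonUnitalCStarAlgebra B] [PartialOrder B] [StarOrderedRing B]

/-- A unitary isomorphism of `A`-`B`-correspondences (right linearity follows from the other
properties). -/
structure BimUnitary (E : Corr.{w₁} A B) (F : Corr.{w₂} A B) where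
  toEquiv : E ≃ₗᵢ[ℂ] F
  map_ip : ∀ x y, F.ip (toEquiv x) (toEquiv y) = E.ip x y
  map_lact : ∀ (a : A) x, toEquiv (E.lact a x) = F.lact a (toEquiv x)

/-- The underlying continuous linear map of a unitary isomorphism. -/
noncomputable def BimUnitary.toCLM {E : Corr.{w₁} A B} {F : Corr.{w₂} A B} (U : BimUnitary E F) :
    E →L[ℂ] F := U.toEquiv.toContinuousLinearEquiv.toContinuousLinearMap

open UnitaryTensorCategory Corr

/-- An action of `𝒞` on `A`: a C⋆-tensor functor from `𝒞` to the nondegenerate correspondences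
over `A`. The identities between bounded maps on interior tensor products are stated on elementary
tensors, which span a dense subspace. -/
structure CAction (𝒞 : Type u) [Category.{v} 𝒞] [Preadditive 𝒞] [Linear ℂ 𝒞]
    [MonoidalCategory 𝒞] [MonoidalPreadditive 𝒞] [MonoidalLinear ℂ 𝒞] [UnitaryTensorCategory 𝒞]
    (A : Type uA) [NonUnitalCStarAlgebra A] [PartialOrder A] [StarOrderedRing A] where
  obj : 𝒞 → Corr.{w} A A
  nondegenerate : ∀ X, (obj X).Nondegenerate
  /-- the action on morphisms, by adjointable bimodule maps -/
  map : ∀ {X Y : 𝒞}, (X ⟶ Y) →ₗ[ℂ] (obj X →L[ℂ] obj Y)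
  map_lact : ∀ {X Y : 𝒞} (f : X ⟶ Y) (a : A) (x : obj X),
    map f ((obj X).lact a x) = (obj Y).lact a (map f x)
  /-- `α(f)` is adjointable with `α(f)⋆ = α(f⋆)` -/
  map_dag : ∀ {X Y : 𝒞} (f : X ⟶ Y) (x : obj X) (y : obj Y),
    (obj Y).ip (map f x) y = (obj X).ip x (map (dag f) y)
  map_id : ∀ (X : 𝒞) (x : obj X), map (𝟙 X) x = x
  map_comp : ∀ {X Y Z : 𝒞} (f : X ⟶ Y) (g : Y ⟶ Z) (x : obj X), map (f ≫ g) x = map g (map f x)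
  /-- the unitary identification of `A` with `α(1)` -/
  unit : BimUnitary (Corr.self A) (obj (𝟙_ 𝒞))
  /-- the unitaries `u_{X,Y} : α(X) ⊗ α(Y) → α(X ⊗ Y)` -/
  mul : ∀ X Y : 𝒞, BimUnitary ((obj X).tensor (obj Y)) (obj (X ⊗ Y))
  mul_natural : ∀ {X Y X' Y' : 𝒞} (f : X ⟶ X') (g : Y ⟶ Y') (x : obj X) (y : obj Y),
    (mul X' Y').toEquiv (tmul _ _ (map f x) (map g y)) = map (f ⊗ₘ g) ((mul X Y).toEquiv (tmul _ _ x y))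
  mul_assoc : ∀ (X Y Z : 𝒞) (x : obj X) (y : obj Y) (z : obj Z),
    map (α_ X Y Z).hom ((mul (X ⊗ Y) Z).toEquiv (tmul _ _ ((mul X Y).toEquiv (tmul _ _ x y)) z)) =
      (mul X (Y ⊗ Z)).toEquiv (tmul _ _ x ((mul Y Z).toEquiv (tmul _ _ y z)))
  unit_mul : ∀ (X : 𝒞) (a : A) (x : obj X),
    map (λ_ X).hom ((mul (𝟙_ 𝒞) X).toEquiv (tmul _ _ (unit.toEquiv a) x)) = (obj X).lact a x
  mul_unit : ∀ (X : 𝒞) (x : obj X) (a : A),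
    map (ρ_ X).hom ((mul X (𝟙_ 𝒞)).toEquiv (tmul _ _ x (unit.toEquiv a))) = (obj X).rsmul x a

variable {𝒞 : Type u} [Category.{v} 𝒞] [Preadditive 𝒞] [Linear ℂ 𝒞]
    [MonoidalCategory 𝒞] [MonoidalPreadditive 𝒞] [MonoidalLinear ℂ 𝒞] [UnitaryTensorCategory 𝒞]

/-- A `𝒞`-equivariant structure on an `A`-`B`-correspondence `E`: a natural family of bilinear
(not necessarily adjointable) isometries `u_X : α(X) ⊗ E → E ⊗ β(X)` satisfying the pentagon
identity. -/
structure EquivariantStructure (α : CAction.{w₁} 𝒞 A) (β : CAction.{w₂} 𝒞 B)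
    (E : Corr.{w₃} A B) where
  u : ∀ X : 𝒞, (α.obj X).tensor E →ₗᵢ[ℂ] E.tensor (β.obj X)
  u_lact : ∀ (X : 𝒞) (a : A) (z : (α.obj X).tensor E),
    u X (((α.obj X).tensor E).lact a z) = (E.tensor (β.obj X)).lact a (u X z)
  u_rsmul : ∀ (X : 𝒞) (z : (α.obj X).tensor E) (b : B),
    u X (((α.obj X).tensor E).rsmul z b) = (E.tensor (β.obj X)).rsmul (u X z) b
  natural : ∀ {X Y : 𝒞} (f : X ⟶ Y) (z : (α.obj X).tensor E),
    u Y (rTensor (α.obj X) (α.obj Y) E (α.map f) z) =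
      lTensor E (β.obj X) (β.obj Y) (β.map f) (u X z)
  pentagon : ∀ (X Y : 𝒞) (z : ((α.obj X).tensor (α.obj Y)).tensor E),
    u (X ⊗ Y) (rTensor ((α.obj X).tensor (α.obj Y)) (α.obj (X ⊗ Y)) E (α.mul X Y).toCLM z) =
      lTensor E ((β.obj X).tensor (β.obj Y)) (β.obj (X ⊗ Y)) (β.mul X Y).toCLM
        (assoc E (β.obj X) (β.obj Y)
          (rTensor ((α.obj X).tensor E) (E.tensor (β.obj X)) (β.obj Y)
              (u X).toContinuousLinearMap
            (assocInv (α.obj X) E (β.obj Y)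
              (lTensor (α.obj X) ((α.obj Y).tensor E) (E.tensor (β.obj Y))
                  (u Y).toContinuousLinearMap
                (assoc (α.obj X) (α.obj Y) E z)))))

/-- Families of linear maps `φ_X : α(X) → L(B, β(X))` compatible with a `*`-homomorphism
`φ : A → M(B)`. -/
structure CompatibleFamily (α : CAction.{w₁} 𝒞 A) (β : CAction.{w₂} 𝒞 B)
    (φ : A →⋆ₙₐ[ℂ] 𝓜(ℂ, B)) where
  map : ∀ X : 𝒞, α.obj X →ₗ[ℂ] Adj (Corr.self B).toHilbMod (β.obj X).toHilbMod
  /-- `φ_1(a) = φ(a)`, under the identifications `A = α(1)` and `B = β(1)` -/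
  map_unit : ∀ (a : A) (b : B),
    (map (𝟙_ 𝒞) (α.unit.toEquiv a)).1 b = β.unit.toEquiv ((φ a).fst b)
  /-- `φ_X(a ▷ ξ) = φ(a) ▷ φ_X(ξ)` -/
  map_lact : ∀ (X : 𝒞) (a : A) (ξ : α.obj X) (b : B),
    (map X ((α.obj X).lact a ξ)).1 b = multAct (β.obj X) (φ a) ((map X ξ).1 b)
  /-- `φ_X(ξ ◁ a) = φ_X(ξ) ◁ φ(a)` -/
  map_rsmul : ∀ (X : 𝒞) (ξ : α.obj X) (a : A) (b : B),
    (map X ((α.obj X).rsmul ξ a)).1 b = (map X ξ).1 ((φ a).fst b)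
  /-- `φ(⟨η, ξ⟩) = φ_X(η)⋆ φ_X(ξ)` -/
  map_ip : ∀ (X : 𝒞) (η ξ : α.obj X),
    mulOp (φ ((α.obj X).ip η ξ)) = adjoint (map X η) ∘L (map X ξ).1
  /-- `φ_{X ⊗ Y}(u_{X,Y}(ξ ⊗ ζ)) = v_{X,Y} (φ_X(ξ) ⊗ id) l φ_Y(ζ)` -/
  map_mul : ∀ (X Y : 𝒞) (ξ : α.obj X) (ζ : α.obj Y) (b : B),
    (map (X ⊗ Y) ((α.mul X Y).toEquiv (tmul _ _ ξ ζ))).1 b =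
      (β.mul X Y).toEquiv
        (rTensor (Corr.self B) (β.obj X) (β.obj Y) (map X ξ).1 (lUnit (β.obj Y) ((map Y ζ).1 b)))
  /-- `φ_Y ∘ α(f) = β(f) ∘ φ_X` -/
  map_natural : ∀ {X Y : 𝒞} (f : X ⟶ Y) (ξ : α.obj X) (b : B),
    (map Y (α.map f ξ)).1 b = β.map f ((map X ξ).1 b)

end Categories

end CocycleRep

/-!
Write `T_X(ξ) b = l⋆ u_X(ξ ⊗ b)` for `ξ ∈ α(X)` and `b ∈ B`, where `l : β(X) → B ⊗ β(X)` is the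
canonical unitary. The proof compares equivariant structures and compatible families through the
intermediate notion `IsCocycleFamily`: bounded operators `T_X(ξ) : B → β(X)` which satisfy the left
linearity, inner product, multiplicativity and naturality conditions, with adjointability and the
condition at the unit object left out.

Most of the translation is direct. Right linear isometries preserve inner products
(`HilbMod.ip_map_of_isometry`), so isometry of `u_X` is the identity
`⟨T(η) b, T(ξ) c⟩ = b⋆ φ(⟨η, ξ⟩) c`, and this identity conversely lets `ξ ⊗ b ↦ T(ξ) b` extend to an
isometry on the interior tensor product. Evaluated at `(ξ ⊗ ζ) ⊗ b`, the pentagon identity becomes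
multiplicativity (`EquivariantStructure.pentagon_iff`).

Two conditions have to be derived.

* The unit (`IsCocycleFamily.map_unit`). Multiplicativity at `1 ⊗ 1 ≅ 1` shows that
  `T(a) (T(a') b - φ(a') b) = 0`, and the inner product identity turns this into
  `φ(a) T(a') b = φ(a a') b`. By left linearity `T(a a') = φ(a a')`, and products are dense.

* Adjointability (`IsCocycleFamily.mem_Adj`). The isometries `u_X` need not be adjointable, and the
  adjoint of `T(ξ)` comes from a conjugate `X'` of `X`. Let `R : 1 → X' ⊗ X` and
  `R' : 1 → X ⊗ X'` solve the conjugate equations. For `η ∈ α(X')`, let `S_η : β(X) → B` be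
  `β(R⋆) v (T(η) ⊗ id) l`. Moving `T(η) ⊗ id` across the inner product contracts against `η`
  (`IsCocycleFamily.ip_contract_insert`), which shows that `φ(a⋆) S_η` is adjoint to `T(ξ)` for
  `ξ` the contraction of `α(R) a` against `η` (`IsCocycleFamily.ip_contract_conj`). By the
  conjugate equation, a suitable `η` obtained from `α(R') a'` makes this `ξ` equal to
  `a'⋆ ▷ x ◁ a` for any prescribed `x ∈ α(X)` (`CAction.contract_conj`). Such vectors span a dense
  subspace, and the adjointable operators are norm closed (`isClosed_Adj`).
-/

namespace CocycleRep

universe w w₁ w₂ w₃ u v uA uB uC uD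

variable {A : Type uA} [NonUnitalCStarAlgebra A] [PartialOrder A] [StarOrderedRing A]
variable {B : Type uB} [NonUnitalCStarAlgebra B] [PartialOrder B] [StarOrderedRing B]
variable {C : Type uC} [NonUnitalCStarAlgebra C] [PartialOrder C] [StarOrderedRing C]
variable {D : Type uD} [NonUnitalCStarAlgebra D] [PartialOrder D] [StarOrderedRing D]

/-! ### Hilbert modules -/

/-- Sesquilinear forms are determined by their diagonal. -/
lemma sesquilinear_ext {V W : Type*} [AddCommGroup V] [Module ℂ V] [AddCommGroup W] [Module ℂ W]
    (f g : V →ₗ⋆[ℂ] V →ₗ[ℂ] W) (h : ∀ x, f x x = g x x) (x y : V) : f x y = g x y := by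
  have key : ∀ x, (f - g) x x = 0 := fun x => by simp [h]
  suffices (f - g) x y = 0 by simpa [sub_eq_zero] using this
  generalize f - g = d at key
  have h1 := key (x + y)
  have h2 := key (x + Complex.I • y)
  simp only [map_add, LinearMap.add_apply, key, zero_add, add_zero, map_smul,
    LinearMap.map_smulₛₗ, LinearMap.smul_apply, Complex.conj_I, smul_zero] at h1 h2
  have h3 : d y x = - d x y := eq_neg_of_add_eq_zero_left h1
  rw [h3, neg_smul, smul_neg, neg_neg, ← two_smul ℂ, smul_smul] at h2
  exact (smul_eq_zero.1 h2).resolve_left (by simp)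

namespace HilbMod

lemma eq_zero_of_ip_self {E : HilbMod.{w} B} {x : E} (h : E.form.ip x x = 0) : x = 0 := by
  have h1 := E.norm_sq x
  rw [h, norm_zero] at h1
  exact norm_eq_zero.1 (pow_eq_zero_iff two_ne_zero |>.1 h1)

lemma ext_ip_right {E : HilbMod.{w} B} {x y : E} (h : ∀ z, E.form.ip z x = E.form.ip z y) :
    x = y := by
  rw [← sub_eq_zero]
  apply eq_zero_of_ip_self
  rw [map_sub, h, sub_self]

lemma ext_ip_left {E : HilbMod.{w} B} {x y : E} (h : ∀ z, E.form.ip x z = E.form.ip y z) :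
    x = y :=
  ext_ip_right fun z => by rw [← E.form.star_ip, h, E.form.star_ip]

/-- The inner product of a Hilbert module as a continuous sesquilinear map. -/
noncomputable def ipL (E : HilbMod.{w} B) : E →L⋆[ℂ] E →L[ℂ] B :=
  LinearMap.mkContinuous₂ E.form.ip 1 fun x y => by
    rw [one_mul]; exact Corr.norm_ip_le E x y

@[fun_prop]
lemma continuous_ip {X : Type*} [TopologicalSpace X] (E : HilbMod.{w} B) {f g : X → E}
    (hf : Continuous f) (hg : Continuous g) : Continuous fun x => E.form.ip (f x) (g x) := by
  have h : Continuous fun x => E.ipL (f x) (g x) := by fun_prop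
  exact h

/-- A right linear isometry preserves the inner product, whether or not it is adjointable. -/
lemma ip_map_of_isometry {E : HilbMod.{w₁} B} {F : HilbMod.{w₂} B} (T : E →ₗᵢ[ℂ] F)
    (hT : ∀ (x : E) (b : B), T (E.rsmul x b) = F.rsmul (T x) b) (x y : E) :
    F.form.ip (T x) (T y) = E.form.ip x y := by
  refine sesquilinear_ext ((F.form.ip.comp T.toLinearMap).compl₂ T.toLinearMap) E.form.ip
    (fun x => ?_) x y
  change F.form.ip (T x) (T x) = E.form.ip x x
  have h : ∀ b : B, ‖star b * F.form.ip (T x) (T x) * b‖ = ‖star b * E.form.ip x x * b‖ := by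
    intro b
    rw [← F.form.ip_rsmul_left, ← F.form.ip_rsmul, ← E.form.ip_rsmul_left, ← E.form.ip_rsmul,
      ← E.norm_sq]
    have := hT x b
    unfold HilbMod.rsmul at this
    rw [← this, ← F.norm_sq, T.norm_map]
  exact le_antisymm
    (le_of_forall_norm_conj_le (F.form.ip_self_nonneg _) (E.form.ip_self_nonneg _)
      fun b => (h b).le)
    (le_of_forall_norm_conj_le (E.form.ip_self_nonneg _) (F.form.ip_self_nonneg _)
      fun b => (h b).ge)

/-- A map with an adjoint is right linear. -/
lemma map_rsmul_of_adjoint {E : HilbMod.{w₁} B} {F : HilbMod.{w₂} B} {T : E → F} {S : F → E}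
    (h : ∀ x y, F.form.ip (T x) y = E.form.ip x (S y)) (x : E) (b : B) :
    T (E.rsmul x b) = F.rsmul (T x) b :=
  ext_ip_left fun z => by
    unfold HilbMod.rsmul
    rw [h, E.form.ip_rsmul_left, F.form.ip_rsmul_left, h]

lemma norm_rsmul_le (E : HilbMod.{w} B) (x : E) (b : B) : ‖E.rsmul x b‖ ≤ ‖b‖ * ‖x‖ := by
  have h : ∀ z : E, E.form.snorm z = ‖z‖ := fun z => by
    rw [SemiInner.snorm, ← E.norm_sq, Real.sqrt_sq (norm_nonneg _)]
  have := E.form.snorm_rsmul_le b x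
  rwa [h, h] at this

/-- The right action of an algebra element as a bounded operator. -/
noncomputable def rsmulL (E : HilbMod.{w} B) (b : B) : E →L[ℂ] E :=
  (E.form.rsmul b).mkContinuous ‖b‖ fun x => E.norm_rsmul_le x b

end HilbMod

lemma BimUnitary.map_rsmul {E : Corr.{w₁} A B} {F : Corr.{w₂} A B} (U : BimUnitary E F) (x : E)
    (b : B) : U.toEquiv (E.rsmul x b) = F.rsmul (U.toEquiv x) b := by
  refine HilbMod.ext_ip_right fun z => ?_
  obtain ⟨z, rfl⟩ := U.toEquiv.surjective z
  have h := U.map_ip z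
  unfold HilbMod.ip at h
  unfold HilbMod.rsmul
  rw [h, E.form.ip_rsmul, F.form.ip_rsmul, h]

namespace Corr

/-- The left action of an algebra element as a bounded operator. -/
noncomputable def lactL (E : Corr.{w} A B) (a : A) : E →L[ℂ] E :=
  (show E →ₗ[ℂ] E from E.lact a).mkContinuous ‖a‖ (norm_lact_le E a)

/-- The orbit map `a ↦ a ▷ x` as a bounded operator. -/
noncomputable def orbitL (E : Corr.{w} A B) (x : E) : A →L[ℂ] E :=
  ((LinearMap.applyₗ (R := ℂ) x).comp (E.lact : A →ₗ[ℂ] Module.End ℂ E)).mkContinuous ‖x‖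
    fun a => by rw [mul_comm]; exact norm_lact_le E a x

end Corr

namespace Corr

/-! ### Interior tensor products -/

section Tensor

variable {E : Corr.{w₁} A B} {F : Corr.{w₂} B C}

lemma ip_tmul (x x' : E) (y y' : F) :
    (E.tensor F).form.ip (tmul E F x y) (tmul E F x' y') =
      F.form.ip y (F.lact (E.form.ip x x') y') :=
  tensorH_ip E.toHilbMod F _ _

lemma lact_tmul (a : A) (x : E) (y : F) :
    (E.tensor F).lact a (tmul E F x y) = tmul E F (E.lact a x) y :=
  tensorLact_toTensor E F a _

lemma rsmul_ofAlg (z : E ⊗[ℂ] F) (c : C) :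
    (E.tensor F).rsmul (ofAlg E F z) c =
      ofAlg E F (TensorProduct.map LinearMap.id (F.form.rsmul c) z) :=
  (tensorForm E.toHilbMod F).complRsmul_ι c z

lemma rsmul_tmul (x : E) (y : F) (c : C) :
    (E.tensor F).rsmul (tmul E F x y) c = tmul E F x (F.rsmul y c) :=
  rsmul_ofAlg _ c

/-- A bounded map out of an interior tensor product is determined by elementary tensors. -/
lemma tensor_ext {W : Type*} [NormedAddCommGroup W] [NormedSpace ℂ W]
    {f g : E.tensor F →L[ℂ] W} (h : ∀ x y, f (tmul E F x y) = g (tmul E F x y)) : f = g :=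
  ContinuousLinearMap.ext_on (dense_span_tmul E F) <| by
    rintro _ ⟨⟨x, y⟩, rfl⟩
    exact h x y

lemma rTensor_tmul {E' : Corr.{w₃} A B} (T : E →L[ℂ] E')
    (hT : ∀ (x : E) (b : B), T (E.rsmul x b) = E'.rsmul (T x) b) (x : E) (y : F) :
    rTensor E E' F T (tmul E F x y) = tmul E' F (T x) y :=
  rTensor_ofAlg E E' F T hT _

lemma lTensor_tmul {F' : Corr.{w₃} B C} (S : F →L[ℂ] F')
    (hS : ∀ (x : F) (c : C), S (F.rsmul x c) = F'.rsmul (S x) c)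
    (hS' : ∀ (b : B) (x : F), S (F.lact b x) = F'.lact b (S x)) (x : E) (y : F) :
    lTensor E F F' S (tmul E F x y) = tmul E F' x (S y) :=
  lTensor_ofAlg E F F' S hS hS' _

lemma assoc_tmul {G : Corr.{w₃} C D} (x : E) (y : F) (z : G) :
    assoc E F G (tmul (E.tensor F) G (tmul E F x y) z) =
      tmul E (F.tensor G) x (tmul F G y z) :=
  assoc_ofAlgLeft E F G ((x ⊗ₜ y) ⊗ₜ z)

lemma assocInv_tmul {G : Corr.{w₃} C D} (x : E) (y : F) (z : G) :
    assocInv E F G (tmul E (F.tensor G) x (tmul F G y z)) =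
      tmul (E.tensor F) G (tmul E F x y) z :=
  assocInv_ofAlgRight E F G ((x ⊗ₜ y) ⊗ₜ z)

@[simp] lemma tmulL_apply (x : E) (y : F) : tmulL E F x y = tmul E F x y := rfl

/-- A bounded map out of `(E ⊗ F) ⊗ G` is determined by the tensors `(x ⊗ y) ⊗ z`. -/
lemma tensor_ext₃ {G : Corr.{w₃} C D} {W : Type*} [NormedAddCommGroup W] [NormedSpace ℂ W]
    {f g : (E.tensor F).tensor G →L[ℂ] W}
    (h : ∀ x y z, f (tmul _ _ (tmul E F x y) z) = g (tmul _ _ (tmul E F x y) z)) : f = g := by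
  refine tensor_ext fun w z => ?_
  have : f ∘L (tmulL (E.tensor F) G).flip z = g ∘L (tmulL (E.tensor F) G).flip z :=
    tensor_ext fun x y => h x y z
  exact DFunLike.congr_fun this w

section Contraction

variable (E F)

/-- The algebraic contraction `x ⊗ y ↦ ⟨η, x⟩ ▷ y`. -/
noncomputable def algContract (η : E) : (E ⊗[ℂ] F) →ₗ[ℂ] F :=
  TensorProduct.lift ((F.lact : B →ₗ[ℂ] Module.End ℂ F).comp (E.form.ip η))

lemma ip_algContract (η : E) (t : E ⊗[ℂ] F) (y : F) :
    F.form.ip (algContract E F η t) y = (E.tensor F).form.ip (ofAlg E F t) (tmul E F η y) := by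
  induction t using TensorProduct.induction_on with
  | zero => simp
  | add t t' h h' => simp only [map_add, LinearMap.add_apply, h, h']
  | tmul x y' =>
    refine Eq.trans ?_ (ip_tmul x η y' y).symm
    rw [← E.form.star_ip η x, ← F.ip_lact]
    rfl

/-- The contraction `x ⊗ y ↦ ⟨η, x⟩ ▷ y` on the interior tensor product; it is the adjoint of
`y ↦ η ⊗ y`. -/
noncomputable def contract (η : E) : E.tensor F →L[ℂ] F :=
  (algContract E F η).extendOfNorm (ofAlg E F)

lemma contract_ofAlg (η : E) (t : E ⊗[ℂ] F) :
    contract E F η (ofAlg E F t) = algContract E F η t := by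
  refine LinearMap.extendOfNorm_eq (denseRange_ofAlg E F) ⟨‖η‖, fun t => ?_⟩ t
  have h1 := F.norm_sq (algContract E F η t)
  rw [ip_algContract] at h1
  have h2 := norm_ip_le (E.tensor F).toHilbMod (ofAlg E F t) (tmul E F η (algContract E F η t))
  have h3 := norm_tmul_le E F η (algContract E F η t)
  rcases (norm_nonneg (algContract E F η t)).eq_or_lt with h0 | h0
  · rw [← h0]; positivity
  · refine le_of_mul_le_mul_right ?_ h0
    calc _ = ‖algContract E F η t‖ ^ 2 := (sq _).symm
      _ ≤ ‖ofAlg E F t‖ * (‖η‖ * ‖algContract E F η t‖) := by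
        rw [h1]; exact h2.trans (by gcongr)
      _ = _ := by ring

lemma contract_tmul (η x : E) (y : F) :
    contract E F η (tmul E F x y) = F.lact (E.form.ip η x) y :=
  contract_ofAlg E F η _

lemma ip_contract (η : E) (y : F) (t : E.tensor F) :
    (E.tensor F).form.ip t (tmul E F η y) = F.form.ip (contract E F η t) y := by
  refine tensorH_induction (E := E.toHilbMod) (F := F)
    (p := fun t => (E.tensor F).form.ip t (tmul E F η y) = F.form.ip (contract E F η t) y)
    (isClosed_eq ?_ ?_) (fun t => ?_) t
  · exact (E.tensor F).continuous_ip continuous_id continuous_const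
  · exact F.continuous_ip (contract E F η).continuous continuous_const
  · change _ = F.form.ip (contract E F η (ofAlg E F t)) y
    rw [contract_ofAlg, ip_algContract]
    rfl

end Contraction

end Tensor

/-! ### The unitary `l` and the action of multipliers -/

section LUnit

variable {E : Corr.{w₁} A B}

/-- A bounded map out of a nondegenerate correspondence is determined on the vectors `a ▷ x`. -/
lemma Nondegenerate.clm_ext (hE : E.Nondegenerate) {W : Type*} [NormedAddCommGroup W]
    [NormedSpace ℂ W] {f g : E →L[ℂ] W} (h : ∀ a x, f (E.lact a x) = g (E.lact a x)) : f = g :=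
  ContinuousLinearMap.ext_on hE <| by
    rintro _ ⟨a, x, rfl⟩
    exact h a x

/-- Equality of `B`-valued inner products, tested on the vectors `a ▷ x` in both variables. -/
lemma Nondegenerate.ip_ext (hE : E.Nondegenerate) {F : HilbMod.{w₂} C} {F' : HilbMod.{w₃} C}
    {f g : E →L[ℂ] F} {f' g' : E →L[ℂ] F'}
    (h : ∀ a x b y, F.form.ip (f (E.lact a x)) (g (E.lact b y)) =
      F'.form.ip (f' (E.lact a x)) (g' (E.lact b y))) (x y : E) :
    F.form.ip (f x) (g y) = F'.form.ip (f' x) (g' y) := by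
  have h1 : ∀ a x y, F.form.ip (f (E.lact a x)) (g y) = F'.form.ip (f' (E.lact a x)) (g' y) := by
    intro a x y
    have : (F.ipL (f (E.lact a x))).comp g = (F'.ipL (f' (E.lact a x))).comp g' :=
      hE.clm_ext fun b y => h a x b y
    exact DFunLike.congr_fun this y
  rw [← F.form.star_ip, ← F'.form.star_ip]
  congr 1
  have : (F.ipL (g y)).comp f = (F'.ipL (g' y)).comp f' := by
    refine hE.clm_ext fun a x => ?_
    change F.form.ip (g y) (f (E.lact a x)) = F'.form.ip (g' y) (f' (E.lact a x))
    rw [← F.form.star_ip, h1, F'.form.star_ip]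
  exact DFunLike.congr_fun this x

lemma lUnit_lact (hE : E.Nondegenerate) (a : A) (x : E) :
    lUnit E (E.lact a x) = tmul (self A) E a x :=
  lUnit_mulMap E hE ((show self A from a) ⊗ₜ x)

lemma lUnitAdj_tmul (a : A) (x : E) : lUnitAdj E (tmul (self A) E a x) = E.lact a x :=
  lUnitAdj_ofAlg E ((show self A from a) ⊗ₜ x)

lemma lUnitAdj_lUnit (hE : E.Nondegenerate) (x : E) : lUnitAdj E (lUnit E x) = x := by
  have : lUnitAdj E ∘L lUnit E = ContinuousLinearMap.id ℂ E := hE.clm_ext fun a x => by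
    simp [lUnit_lact hE, lUnitAdj_tmul]
  exact DFunLike.congr_fun this x

lemma lUnit_lUnitAdj (hE : E.Nondegenerate) (z : (self A).tensor E) :
    lUnit E (lUnitAdj E z) = z := by
  have : lUnit E ∘L lUnitAdj E = ContinuousLinearMap.id ℂ _ := tensor_ext fun a x => by
    exact (congrArg (lUnit E) (lUnitAdj_tmul (E := E) a x)).trans (lUnit_lact hE a x)
  exact DFunLike.congr_fun this z

lemma ip_lUnit (hE : E.Nondegenerate) (x y : E) :
    ((self A).tensor E).form.ip (lUnit E x) (lUnit E y) = E.form.ip x y := by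
  refine hE.ip_ext (F := ((self A).tensor E).toHilbMod) (F' := E.toHilbMod) (f := lUnit E)
    (g := lUnit E) (f' := .id ℂ E) (g' := .id ℂ E) (fun a x b y => ?_) x y
  rw [lUnit_lact hE, lUnit_lact hE]
  exact (ip_tmul (E := self A) (F := E) _ _ _ _).trans (mulMap_ip_aux E a b x y).symm

lemma ip_lUnitAdj (hE : E.Nondegenerate) (x y : (self A).tensor E) :
    E.form.ip (lUnitAdj E x) (lUnitAdj E y) = ((self A).tensor E).form.ip x y := by
  rw [← ip_lUnit hE, lUnit_lUnitAdj hE, lUnit_lUnitAdj hE]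

lemma norm_lUnit (hE : E.Nondegenerate) (x : E) : ‖lUnit E x‖ = ‖x‖ := by
  refine (sq_eq_sq₀ (norm_nonneg _) (norm_nonneg _)).1 ?_
  rw [E.norm_sq, ← ip_lUnit hE]
  exact ((self A).tensor E).norm_sq _

lemma lUnit_rsmul (hE : E.Nondegenerate) (x : E) (b : B) :
    lUnit E (E.rsmul x b) = ((self A).tensor E).rsmul (lUnit E x) b :=
  HilbMod.map_rsmul_of_adjoint (E := E.toHilbMod) (F := ((self A).tensor E).toHilbMod)
    (T := lUnit E) (S := lUnitAdj E)
    (fun x y => by rw [← ip_lUnitAdj hE, lUnitAdj_lUnit hE]) x b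

/-- `l` is natural for bounded bimodule maps. -/
lemma lTensor_lUnit {F : Corr.{w₂} A B} (hE : E.Nondegenerate) (hF : F.Nondegenerate)
    (S : E →L[ℂ] F) (hS : ∀ (x : E) (b : B), S (E.rsmul x b) = F.rsmul (S x) b)
    (hS' : ∀ (a : A) (x : E), S (E.lact a x) = F.lact a (S x)) (x : E) :
    lTensor (self A) E F S (lUnit E x) = lUnit F (S x) := by
  have : lTensor (self A) E F S ∘L lUnit E = lUnit F ∘L S := hE.clm_ext fun a x => by
    simp only [ContinuousLinearMap.comp_apply]
    rw [lUnit_lact hE, hS', lUnit_lact hF]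
    exact lTensor_tmul (E := self A) S hS hS' a x
  exact DFunLike.congr_fun this x

/-- Multipliers act right linearly. -/
lemma mulOp_rsmul (h : 𝓜(ℂ, A)) (x y : A) : h.fst (x * y) = h.fst x * y := by
  have key : ∀ z : A, z * h.fst (x * y) = z * (h.fst x * y) := fun z => by
    rw [← h.central, ← mul_assoc, h.central, mul_assoc]
  rw [← sub_eq_zero, ← CStarRing.star_mul_self_eq_zero_iff, mul_sub, key, sub_self]

/-- The action of a multiplier on a nondegenerate correspondence, as a bounded operator. -/
noncomputable def multActL (E : Corr.{w₁} A B) (h : 𝓜(ℂ, A)) : E →L[ℂ] E :=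
  lUnitAdj E ∘L rTensor (self A) (self A) E (mulOp h) ∘L lUnit E

lemma multActL_apply (h : 𝓜(ℂ, A)) (x : E) : multActL E h x = multAct E h x := rfl

lemma multAct_lact (hE : E.Nondegenerate) (h : 𝓜(ℂ, A)) (a : A) (x : E) :
    multAct E h (E.lact a x) = E.lact (h.fst a) x := by
  have h1 := rTensor_tmul (E := self A) (E' := self A) (F := E) (mulOp h)
    (fun x y => mulOp_rsmul h x y) a x
  rw [multAct, lUnit_lact hE]
  exact (congrArg (lUnitAdj E) h1).trans (lUnitAdj_tmul _ _)

lemma lUnit_multAct (hE : E.Nondegenerate) (h : 𝓜(ℂ, A)) (x : E) :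
    lUnit E (multAct E h x) = rTensor (self A) (self A) E (mulOp h) (lUnit E x) :=
  lUnit_lUnitAdj hE _

/-- `(id ⊗ v) (l_E ⊗ id) = l v` under the associativity isomorphism, for a bounded bimodule map `v`
out of `E ⊗ F`. -/
lemma lTensor_assoc_lUnit {F : Corr.{w₂} B C} {G : Corr.{w₃} A C} (hE : E.Nondegenerate)
    (hG : G.Nondegenerate) (V : E.tensor F →L[ℂ] G)
    (hV : ∀ z (c : C), V ((E.tensor F).rsmul z c) = G.rsmul (V z) c)
    (hV' : ∀ (a : A) z, V ((E.tensor F).lact a z) = G.lact a (V z)) (x : E) (y : F) :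
    lTensor (self A) (E.tensor F) G V
        (assoc (self A) E F (tmul ((self A).tensor E) F (lUnit E x) y)) =
      lUnit G (V (tmul E F x y)) := by
  have : lTensor (self A) (E.tensor F) G V ∘L assoc (self A) E F ∘L
      (tmulL ((self A).tensor E) F).flip y ∘L lUnit E =
      lUnit G ∘L V ∘L (tmulL E F).flip y := hE.clm_ext fun a x => by
    simp only [ContinuousLinearMap.comp_apply, ContinuousLinearMap.flip_apply, tmulL_apply]
    rw [lUnit_lact hE, ← lact_tmul, hV', lUnit_lact hG]
    exact (congrArg _ (assoc_tmul (E := self A) a x y)).trans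
      (lTensor_tmul (E := self A) V hV hV' a _)
  exact DFunLike.congr_fun this x

end LUnit

end Corr

open UnitaryTensorCategory Corr

variable {𝒞 : Type u} [Category.{v} 𝒞] [Preadditive 𝒞] [Linear ℂ 𝒞]
    [MonoidalCategory 𝒞] [MonoidalPreadditive 𝒞] [MonoidalLinear ℂ 𝒞] [UnitaryTensorCategory 𝒞]

/-! ### Cocycle families of operators -/

lemma BimUnitary.form_ip {E : Corr.{w₁} A B} {F : Corr.{w₂} A B} (U : BimUnitary E F) (x y : E) :
    F.form.ip (U.toEquiv x) (U.toEquiv y) = E.form.ip x y := U.map_ip x y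

namespace CAction

lemma ip_map (α : CAction.{w} 𝒞 A) {X Y : 𝒞} (f : X ⟶ Y) (x : α.obj X) (y : α.obj Y) :
    (α.obj Y).form.ip (α.map f x) y = (α.obj X).form.ip x (α.map (dag f) y) := α.map_dag f x y

lemma map_rsmul (α : CAction.{w} 𝒞 A) {X Y : 𝒞} (f : X ⟶ Y) (x : α.obj X) (a : A) :
    α.map f ((α.obj X).rsmul x a) = (α.obj Y).rsmul (α.map f x) a :=
  HilbMod.map_rsmul_of_adjoint (E := (α.obj X).toHilbMod) (F := (α.obj Y).toHilbMod)
    (T := α.map f) (S := α.map (dag f)) (α.ip_map f) x a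

/-- The identification of `A` with `α(1)`. -/
noncomputable def unitL (α : CAction.{w} 𝒞 A) : A →L[ℂ] α.obj (𝟙_ 𝒞) := α.unit.toCLM

/-- The inverse of the identification of `A` with `α(1)`. -/
noncomputable def unitInv (α : CAction.{w} 𝒞 A) : α.obj (𝟙_ 𝒞) →L[ℂ] A :=
  α.unit.toEquiv.symm.toContinuousLinearEquiv.toContinuousLinearMap

section Unit

variable (α : CAction.{w} 𝒞 A)

@[simp] lemma unitInv_unitL (a : A) : α.unitInv (α.unitL a) = a :=
  α.unit.toEquiv.symm_apply_apply a

@[simp] lemma unitL_unitInv (x : α.obj (𝟙_ 𝒞)) : α.unitL (α.unitInv x) = x :=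
  α.unit.toEquiv.apply_symm_apply x

lemma ip_unitL (a b : A) :
    (α.obj (𝟙_ 𝒞)).form.ip (α.unitL a) (α.unitL b) = star a * b := α.unit.form_ip a b

lemma lact_unitL (a b : A) : (α.obj (𝟙_ 𝒞)).lact a (α.unitL b) = α.unitL (a * b) :=
  (α.unit.map_lact a b).symm

lemma rsmul_unitL (a b : A) : (α.obj (𝟙_ 𝒞)).rsmul (α.unitL a) b = α.unitL (a * b) :=
  (α.unit.map_rsmul a b).symm

lemma map_leftUnitor (X : 𝒞) (a : A) (x : α.obj X) :
    α.map (λ_ X).hom ((α.mul (𝟙_ 𝒞) X).toEquiv (tmul _ _ (α.unitL a) x)) = (α.obj X).lact a x :=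
  α.unit_mul X a x

lemma map_rightUnitor (X : 𝒞) (x : α.obj X) (a : A) :
    α.map (ρ_ X).hom ((α.mul X (𝟙_ 𝒞)).toEquiv (tmul _ _ x (α.unitL a))) = (α.obj X).rsmul x a :=
  α.mul_unit X x a

end Unit

/-- The operator `v_{X,Y} (S ⊗ id) l : β(Y) → β(X ⊗ Y)` attached to `S : B → β(X)`; it sends
`b ▷ y` to `v_{X,Y} (S b ⊗ y)`. -/
noncomputable def insert (β : CAction.{w} 𝒞 B) {X : 𝒞} (S : B →L[ℂ] β.obj X) (Y : 𝒞) :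
    β.obj Y →L[ℂ] β.obj (X ⊗ Y) :=
  (β.mul X Y).toCLM ∘L rTensor (Corr.self B) (β.obj X) (β.obj Y) S ∘L lUnit (β.obj Y)

lemma insert_lact (β : CAction.{w} 𝒞 B) {X : 𝒞} (S : B →L[ℂ] β.obj X)
    (hS : ∀ b c : B, S (b * c) = (β.obj X).rsmul (S b) c) (Y : 𝒞) (b : B) (y : β.obj Y) :
    β.insert S Y ((β.obj Y).lact b y) = (β.mul X Y).toEquiv (tmul _ _ (S b) y) := by
  have h := rTensor_tmul (E := Corr.self B) (F := β.obj Y) S hS b y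
  change (β.mul X Y).toEquiv (rTensor (Corr.self B) (β.obj X) (β.obj Y) S
    (lUnit (β.obj Y) ((β.obj Y).lact b y))) = _
  rw [lUnit_lact (β.nondegenerate Y)]
  exact congrArg _ h

end CAction

/-- A family of bounded operators `T_X(ξ) : B → β(X)`, depending boundedly and linearly on
`ξ ∈ α(X)`, which satisfies the left linearity, inner product, multiplicativity and naturality
conditions of a cocycle representation over `φ`. Adjointability of the operators and the condition
at the unit object are not part of the definition: they follow from the other conditions. -/
structure IsCocycleFamily (α : CAction.{w₁} 𝒞 A) (β : CAction.{w₂} 𝒞 B)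
    (φ : A →⋆ₙₐ[ℂ] 𝓜(ℂ, B)) (T : ∀ X : 𝒞, α.obj X →L[ℂ] B →L[ℂ] β.obj X) : Prop where
  ip : ∀ (X : 𝒞) (η ξ : α.obj X) (b c : B), (β.obj X).form.ip (T X η b) (T X ξ c) =
    star b * (φ ((α.obj X).form.ip η ξ)).fst c
  lact : ∀ (X : 𝒞) (a : A) (ξ : α.obj X) (b : B),
    T X ((α.obj X).lact a ξ) b = multAct (β.obj X) (φ a) (T X ξ b)
  mul : ∀ (X Y : 𝒞) (ξ : α.obj X) (ζ : α.obj Y) (b : B),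
    T (X ⊗ Y) ((α.mul X Y).toEquiv (tmul _ _ ξ ζ)) b = β.insert (T X ξ) Y (T Y ζ b)
  natural : ∀ {X Y : 𝒞} (f : X ⟶ Y) (ξ : α.obj X) (b : B),
    T Y (α.map f ξ) b = β.map f (T X ξ b)

namespace IsCocycleFamily

variable {α : CAction.{w₁} 𝒞 A} {β : CAction.{w₂} 𝒞 B} {φ : A →⋆ₙₐ[ℂ] 𝓜(ℂ, B)}
  {T : ∀ X : 𝒞, α.obj X →L[ℂ] B →L[ℂ] β.obj X}

lemma map_mul_right (hT : IsCocycleFamily α β φ T) (X : 𝒞) (ξ : α.obj X) (b c : B) :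
    T X ξ (b * c) = (β.obj X).rsmul (T X ξ b) c := by
  have h := hT.ip X ξ ξ
  rw [← sub_eq_zero]
  apply HilbMod.eq_zero_of_ip_self
  unfold HilbMod.rsmul
  simp only [map_sub, LinearMap.sub_apply, SemiInner.ip_rsmul, SemiInner.ip_rsmul_left, h,
    mulOp_rsmul, star_mul, mul_assoc, sub_self]

lemma map_rsmul (hT : IsCocycleFamily α β φ T) (X : 𝒞) (ξ : α.obj X) (a : A) (b : B) :
    T X ((α.obj X).rsmul ξ a) b = T X ξ ((φ a).fst b) := by
  rw [← sub_eq_zero]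
  apply HilbMod.eq_zero_of_ip_self
  unfold HilbMod.rsmul
  have h1 : ∀ (p q : A) (c : B), (φ (p * q)).fst c = (φ p).fst ((φ q).fst c) := fun p q c => by
    rw [map_mul]; rfl
  simp only [map_sub, LinearMap.sub_apply, hT.ip, SemiInner.ip_rsmul, SemiInner.ip_rsmul_left, h1,
    ofHom_ip_lact, sub_self]

/-- `⟨T(η) ⊗ w, T(η') ⊗ y⟩ = ⟨w, φ(⟨η, η'⟩) ▷ y⟩`. -/
lemma ip_insert (hT : IsCocycleFamily α β φ T) {X Y : 𝒞} (η η' : α.obj X) (w y : β.obj Y) :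
    (β.obj (X ⊗ Y)).form.ip (β.insert (T X η) Y w) (β.insert (T X η') Y y) =
      (β.obj Y).form.ip w (multAct (β.obj Y) (φ ((α.obj X).form.ip η η')) y) := by
  refine (β.nondegenerate Y).ip_ext (F := (β.obj (X ⊗ Y)).toHilbMod) (F' := (β.obj Y).toHilbMod)
    (f := β.insert (T X η) Y) (g := β.insert (T X η') Y) (f' := .id ℂ (β.obj Y))
    (g' := multActL (β.obj Y) (φ ((α.obj X).form.ip η η'))) (fun b w c y => ?_) w y
  rw [β.insert_lact _ (hT.map_mul_right X η), β.insert_lact _ (hT.map_mul_right X η'),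
    BimUnitary.form_ip, ip_tmul, hT.ip, multActL_apply, multAct_lact (β.nondegenerate Y),
    ContinuousLinearMap.id_apply, mulMap_ip_aux]

end IsCocycleFamily

/-! ### The condition at the unit object -/

/-- A multiplier acts on `β(1) = B` in the obvious way. -/
lemma CAction.multAct_unitL (β : CAction.{w} 𝒞 B) (h : 𝓜(ℂ, B)) (b : B) :
    multAct (β.obj (𝟙_ 𝒞)) h (β.unitL b) = β.unitL (h.fst b) := by
  have : multActL (β.obj (𝟙_ 𝒞)) h = β.unitL ∘L h.fst ∘L β.unitInv := by
    refine (β.nondegenerate _).clm_ext fun c y => ?_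
    rw [← β.unitL_unitInv y]
    simp only [multActL_apply, ContinuousLinearMap.comp_apply]
    rw [multAct_lact (β.nondegenerate _), lact_unitL, lact_unitL, unitInv_unitL, mulOp_rsmul]
  simpa [multActL_apply] using DFunLike.congr_fun this (β.unitL b)

namespace IsCocycleFamily

variable {α : CAction.{w₁} 𝒞 A} {β : CAction.{w₂} 𝒞 B} {φ : A →⋆ₙₐ[ℂ] 𝓜(ℂ, B)}
  {T : ∀ X : 𝒞, α.obj X →L[ℂ] B →L[ℂ] β.obj X}

/-- Multiplicativity at `1 ⊗ 1 ≅ 1`: under `B = β(1)`, the operators `T(a)`, `a ∈ A = α(1)`,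
compose multiplicatively. -/
lemma map_unit_mul (hT : IsCocycleFamily α β φ T) (a a' : A) (b : B) :
    T (𝟙_ 𝒞) (α.unitL (a * a')) b =
      T (𝟙_ 𝒞) (α.unitL a) (β.unitInv (T (𝟙_ 𝒞) (α.unitL a') b)) := by
  rw [← α.lact_unitL, ← α.map_leftUnitor, hT.natural, hT.mul]
  generalize T (𝟙_ 𝒞) (α.unitL a') b = y
  have : β.map (λ_ (𝟙_ 𝒞)).hom ∘L β.insert (T (𝟙_ 𝒞) (α.unitL a)) (𝟙_ 𝒞) =
      T (𝟙_ 𝒞) (α.unitL a) ∘L β.unitInv := by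
    refine (β.nondegenerate _).clm_ext fun c y => ?_
    rw [← β.unitL_unitInv y]
    simp only [ContinuousLinearMap.comp_apply]
    rw [β.insert_lact _ (hT.map_mul_right _ _), β.lact_unitL, β.unitInv_unitL, hT.map_mul_right,
      ← β.unitL_unitInv (T (𝟙_ 𝒞) (α.unitL a) c), β.map_leftUnitor, β.lact_unitL, β.rsmul_unitL]
  exact DFunLike.congr_fun this y

/-- The condition at the unit object is automatic. With `w = T(a') b - φ(a') b`, multiplicativity
gives `T(a) w = 0`, hence `φ(a) w = 0` as `⟨T(a) w, T(a) w⟩ = w⋆ φ(a⋆ a) w`; so `T(a a') = φ(a a')`,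
and the products `a a'` span a dense subspace. -/
lemma map_unit (hT : IsCocycleFamily α β φ T) (a : A) (b : B) :
    T (𝟙_ 𝒞) (α.unitL a) b = β.unitL ((φ a).fst b) := by
  have hφ : ∀ (p q : A) (c : B), (φ (p * q)).fst c = (φ p).fst ((φ q).fst c) := fun p q c => by
    rw [map_mul]; rfl
  have key : ∀ a a' : A, T (𝟙_ 𝒞) (α.unitL (a * a')) b = β.unitL ((φ (a * a')).fst b) := by
    intro a a'
    set p : B := β.unitInv (T (𝟙_ 𝒞) (α.unitL a') b) with hp
    have h1 : T (𝟙_ 𝒞) (α.unitL a) (p - (φ a').fst b) = 0 := by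
      rw [map_sub, ← hT.map_unit_mul, ← hT.map_rsmul, α.rsmul_unitL, sub_self]
    have h2 : (φ a).fst (p - (φ a').fst b) = 0 := by
      have h3 := hT.ip _ (α.unitL a) (α.unitL a) (p - (φ a').fst b) (p - (φ a').fst b)
      rw [h1, map_zero, α.ip_unitL, hφ, ← ofHom_ip_lact, eq_comm,
        CStarRing.star_mul_self_eq_zero_iff] at h3
      exact h3
    rw [map_sub, sub_eq_zero] at h2
    rw [← α.lact_unitL, hT.lact, ← β.unitL_unitInv (T (𝟙_ 𝒞) (α.unitL a') b), β.multAct_unitL,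
      ← hp, h2, hφ]
  have : (T (𝟙_ 𝒞)).flip b = β.unitL ∘L orbitL (ofHom φ) b ∘L α.unitInv := by
    refine (α.nondegenerate _).clm_ext fun a x => ?_
    rw [← α.unitL_unitInv x, α.lact_unitL]
    refine (key _ _).trans ?_
    change _ = β.unitL ((φ (α.unitInv (α.unitL (a * α.unitInv x)))).fst b)
    rw [α.unitInv_unitL]
  refine (DFunLike.congr_fun this (α.unitL a)).trans ?_
  change β.unitL ((φ (α.unitInv (α.unitL a))).fst b) = _
  rw [α.unitInv_unitL]

end IsCocycleFamily

/-! ### Adjointability -/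

section Adj

variable {E : HilbMod.{w₁} B} {F : HilbMod.{w₂} B}

lemma ip_adjoint (T : Adj E F) (x : E) (y : F) :
    F.form.ip (T.1 x) y = E.form.ip x (adjoint T y) := T.2.choose_spec x y

lemma norm_le_of_adjoint {T : E →L[ℂ] F} {S : F →L[ℂ] E}
    (h : ∀ x y, F.form.ip (T x) y = E.form.ip x (S y)) : ‖S‖ ≤ ‖T‖ := by
  refine S.opNorm_le_bound (norm_nonneg _) fun y => ?_
  rcases (norm_nonneg (S y)).eq_or_lt with h0 | h0
  · rw [← h0]; positivity
  · refine le_of_mul_le_mul_right ?_ h0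
    calc ‖S y‖ * ‖S y‖ = ‖F.form.ip (T (S y)) y‖ := by rw [← sq, E.norm_sq, h]
      _ ≤ ‖T‖ * ‖S y‖ * ‖y‖ := (norm_ip_le F _ _).trans (by gcongr; exact T.le_opNorm _)
      _ = ‖T‖ * ‖y‖ * ‖S y‖ := by ring

/-- Adjointable operators form a norm closed subspace: adjoints of a norm convergent sequence form a
Cauchy sequence. -/
lemma isClosed_Adj : IsClosed (Adj E F : Set (E →L[ℂ] F)) := by
  refine isClosed_of_closure_subset fun T hT => ?_
  obtain ⟨t, ht, htT⟩ := mem_closure_iff_seq_limit.1 hT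
  choose s hs using ht
  have hs' : ∀ n x y, F.form.ip (t n x) y = E.form.ip x (s n y) := hs
  have hsc : CauchySeq s := by
    refine Metric.cauchySeq_iff'.2 fun ε hε => ?_
    obtain ⟨N, hN⟩ := Metric.cauchySeq_iff'.1 htT.cauchySeq ε hε
    refine ⟨N, fun n hn => lt_of_le_of_lt ?_ (hN n hn)⟩
    rw [dist_eq_norm, dist_eq_norm]
    refine norm_le_of_adjoint fun x y => ?_
    simp only [sub_apply, map_sub, LinearMap.sub_apply, hs']
  obtain ⟨S, hS⟩ := cauchySeq_tendsto_of_complete hsc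
  refine ⟨S, fun x y => ?_⟩
  have h1 : Filter.Tendsto (fun n => F.form.ip (t n x) y) Filter.atTop
      (nhds (F.form.ip (T x) y)) :=
    (F.continuous_ip (f := fun z : F => z) (g := fun _ => y) continuous_id
      continuous_const).continuousAt.tendsto.comp
      (((ContinuousLinearMap.apply ℂ F x).continuous.tendsto T).comp htT)
  have h2 : Filter.Tendsto (fun n => E.form.ip x (s n y)) Filter.atTop
      (nhds (E.form.ip x (S y))) :=
    (E.continuous_ip (f := fun _ : E => x) (g := fun z => z) continuous_const
      continuous_id).continuousAt.tendsto.comp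
      (((ContinuousLinearMap.apply ℂ E y).continuous.tendsto S).comp hS)
  exact tendsto_nhds_unique (h1.congr fun n => hs' n x y) h2

end Adj

namespace CAction

/-- The inverse of `u_{X,Y}` as a bounded operator. -/
noncomputable def mulInv (α : CAction.{w} 𝒞 A) (X Y : 𝒞) :
    α.obj (X ⊗ Y) →L[ℂ] (α.obj X).tensor (α.obj Y) :=
  (α.mul X Y).toEquiv.symm.toContinuousLinearEquiv.toContinuousLinearMap

lemma mul_mulInv (α : CAction.{w} 𝒞 A) (X Y : 𝒞) (z : α.obj (X ⊗ Y)) :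
    (α.mul X Y).toEquiv (α.mulInv X Y z) = z := (α.mul X Y).toEquiv.apply_symm_apply z

/-- A closed subspace of `α(X)` containing all vectors `a ▷ (x ◁ a')` is everything. -/
lemma eq_top_of_lact_rsmul_mem (α : CAction.{w} 𝒞 A) {X : 𝒞} (M : Submodule ℂ (α.obj X))
    (hM : IsClosed (M : Set (α.obj X)))
    (h : ∀ (a : A) (x : α.obj X) (a' : A), (α.obj X).lact a ((α.obj X).rsmul x a') ∈ M) :
    M = ⊤ := by
  have h1 : ∀ (a : A) (y : α.obj X), (α.obj X).lact a y ∈ M := by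
    intro a y
    -- `α(X) ⊗ α(1) ≅ α(X)` shows that the vectors `x ◁ a'` span a dense subspace
    obtain ⟨z, rfl⟩ : ∃ z, y = α.map (ρ_ X).hom ((α.mul X (𝟙_ 𝒞)).toEquiv z) :=
      ⟨α.mulInv X (𝟙_ 𝒞) (α.map (ρ_ X).inv y), by
        rw [α.mul_mulInv, ← α.map_comp, Iso.inv_hom_id, α.map_id]⟩
    let g : (α.obj X).tensor (α.obj (𝟙_ 𝒞)) →L[ℂ] α.obj X :=
      lactL (α.obj X) a ∘L α.map (ρ_ X).hom ∘L (α.mul X (𝟙_ 𝒞)).toCLM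
    have hle : Submodule.span ℂ (Set.range fun p : α.obj X × α.obj (𝟙_ 𝒞) =>
        tmul (α.obj X) (α.obj (𝟙_ 𝒞)) p.1 p.2) ≤ M.comap g.toLinearMap := by
      rw [Submodule.span_le]
      rintro _ ⟨⟨x, w⟩, rfl⟩
      change (α.obj X).lact a (α.map (ρ_ X).hom ((α.mul X (𝟙_ 𝒞)).toEquiv (tmul _ _ x w))) ∈ M
      rw [← α.unitL_unitInv w, α.map_rightUnitor]
      exact h _ _ _
    exact closure_minimal (t := g ⁻¹' M) hle (hM.preimage g.continuous)
      (dense_span_tmul (α.obj X) (α.obj (𝟙_ 𝒞)) z)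
  have h2 : Submodule.span ℂ {z : α.obj X | ∃ (a : A) (x : α.obj X), z = (α.obj X).lact a x} ≤
      M := by
    rw [Submodule.span_le]
    rintro _ ⟨a, x, rfl⟩
    exact h1 a x
  exact eq_top_iff.2 fun x _ => closure_minimal h2 hM (α.nondegenerate X x)

/-- Conjugate equation in `α(X)`: if `R`, `R'` solve the conjugate equation for `X` and
`η = ⟨x| ⊗ id (α(R') a')`, then contracting `α(R) a` against `η` gives `a'⋆ ▷ x ◁ a`. -/
lemma contract_conj (α : CAction.{w} 𝒞 A) {X X' : 𝒞} (R : 𝟙_ 𝒞 ⟶ X' ⊗ X) (R' : 𝟙_ 𝒞 ⟶ X ⊗ X')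
    (hR : (ρ_ X).inv ≫ (X ◁ R) ≫ (α_ X X' X).inv ≫ (dag R' ▷ X) ≫ (λ_ X).hom = 𝟙 X)
    (x : α.obj X) (a a' : A) :
    contract (α.obj X') (α.obj X)
        (contract (α.obj X) (α.obj X') x (α.mulInv X X' (α.map R' (α.unitL a'))))
        (α.mulInv X' X (α.map R (α.unitL a))) =
      (α.obj X).lact (star a') ((α.obj X).rsmul x a) := by
  set η := contract (α.obj X) (α.obj X') x (α.mulInv X X' (α.map R' (α.unitL a'))) with hη
  -- the conjugate equation, applied to `x ◁ a = α(ρ) u (x ⊗ a)`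
  have h1 : (α.obj X).rsmul x a = α.map (λ_ X).hom (α.map (dag R' ▷ X) (α.map (α_ X X' X).inv
      ((α.mul X (X' ⊗ X)).toEquiv (tmul _ _ x (α.map R (α.unitL a)))))) := by
    have h2 : (α.mul X (X' ⊗ X)).toEquiv (tmul _ _ x (α.map R (α.unitL a))) =
        α.map (X ◁ R) ((α.mul X (𝟙_ 𝒞)).toEquiv (tmul _ _ x (α.unitL a))) := by
      have := α.mul_natural (𝟙 X) R x (α.unitL a)
      rwa [α.map_id, id_tensorHom] at this
    have h3 : (α.mul X (𝟙_ 𝒞)).toEquiv (tmul _ _ x (α.unitL a)) =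
        α.map (ρ_ X).inv ((α.obj X).rsmul x a) := by
      rw [← α.map_rightUnitor, ← α.map_comp, Iso.hom_inv_id, α.map_id]
    rw [h2, h3]
    simp only [← α.map_comp, Category.assoc, hR, α.map_id]
  -- on `η' ⊗ ξ` both sides are `(a'⋆ α(R'⋆) u (x ⊗ η')) ▷ ξ`, as
  -- `a'⋆ α(R'⋆) u (x ⊗ η') = ⟨α(R') a', u (x ⊗ η')⟩ = ⟨η, η'⟩`
  have h4 : lactL (α.obj X) (star a') ∘L α.map (λ_ X).hom ∘L α.map (dag R' ▷ X) ∘L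
      α.map (α_ X X' X).inv ∘L (α.mul X (X' ⊗ X)).toCLM ∘L tmulL (α.obj X) (α.obj (X' ⊗ X)) x ∘L
        (α.mul X' X).toCLM = contract (α.obj X') (α.obj X) η := by
    refine tensor_ext fun η' ξ => ?_
    change (α.obj X).lact (star a') (α.map (λ_ X).hom (α.map (dag R' ▷ X) (α.map (α_ X X' X).inv
      ((α.mul X (X' ⊗ X)).toEquiv (tmul _ _ x ((α.mul X' X).toEquiv (tmul _ _ η' ξ))))))) = _
    rw [contract_tmul, ← α.mul_assoc, ← α.map_comp (α_ X X' X).hom, Iso.hom_inv_id, α.map_id]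
    have h5 := α.mul_natural (dag R') (𝟙 X) ((α.mul X X').toEquiv (tmul _ _ x η')) ξ
    rw [α.map_id, tensorHom_id] at h5
    rw [← h5, ← α.unitL_unitInv (α.map (dag R') _), α.map_leftUnitor, ← Module.End.mul_apply,
      ← map_mul, ← α.ip_unitL, α.unitL_unitInv, ← α.ip_map, ← α.mul_mulInv X X' (α.map R' _),
      BimUnitary.form_ip, hη]
    congr 2
    have h6 : ∀ t, ((α.obj X).tensor (α.obj X')).form.ip t (tmul _ _ x η') =
        (α.obj X').form.ip (contract (α.obj X) (α.obj X') x t) η' := ip_contract _ _ x η'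
    exact h6 _
  have h7 := DFunLike.congr_fun h4 (α.mulInv X' X (α.map R (α.unitL a)))
  rw [← h7, h1]
  conv_rhs => rw [← α.mul_mulInv X' X (α.map R (α.unitL a))]
  rfl

end CAction

namespace IsCocycleFamily

variable {α : CAction.{w₁} 𝒞 A} {β : CAction.{w₂} 𝒞 B} {φ : A →⋆ₙₐ[ℂ] 𝓜(ℂ, B)}
  {T : ∀ X : 𝒞, α.obj X →L[ℂ] B →L[ℂ] β.obj X}

/-- Moving `T(η) ⊗ id` across the inner product contracts against `η`. -/
lemma ip_contract_insert (hT : IsCocycleFamily α β φ T) {X Y : 𝒞} (η : α.obj X)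
    (t : (α.obj X).tensor (α.obj Y)) (b : B) (y : β.obj Y) :
    (β.obj (X ⊗ Y)).form.ip (T (X ⊗ Y) ((α.mul X Y).toEquiv t) b) (β.insert (T X η) Y y) =
      (β.obj Y).form.ip (T Y (contract (α.obj X) (α.obj Y) η t) b) y := by
  rw [← SemiInner.star_ip]
  conv_rhs => rw [← SemiInner.star_ip]
  congr 1
  have : ((β.obj (X ⊗ Y)).ipL (β.insert (T X η) Y y)) ∘L (T (X ⊗ Y)).flip b ∘L (α.mul X Y).toCLM =
      ((β.obj Y).ipL y) ∘L (T Y).flip b ∘L contract (α.obj X) (α.obj Y) η := by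
    refine tensor_ext fun η' ξ => ?_
    change (β.obj (X ⊗ Y)).form.ip (β.insert (T X η) Y y)
      (T (X ⊗ Y) ((α.mul X Y).toEquiv (tmul _ _ η' ξ)) b) =
      (β.obj Y).form.ip y (T Y (contract (α.obj X) (α.obj Y) η (tmul _ _ η' ξ)) b)
    rw [hT.mul, hT.ip_insert, contract_tmul, hT.lact]
  exact DFunLike.congr_fun this t

/-- With `S = β(R⋆) v (T(η) ⊗ id) l : β(X) → β(1) = B`, the operator `φ(a⋆) S` is adjoint to `T(ξ)`,
where `ξ` is the contraction of `α(R) a` against `η`. -/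
lemma ip_contract_conj (hT : IsCocycleFamily α β φ T) {X X' : 𝒞} (R : 𝟙_ 𝒞 ⟶ X' ⊗ X)
    (η : α.obj X') (a : A) (b : B) (y : β.obj X) :
    (β.obj X).form.ip
        (T X (contract (α.obj X') (α.obj X) η (α.mulInv X' X (α.map R (α.unitL a)))) b) y =
      star b * (φ (star a)).fst (β.unitInv (β.map (dag R) (β.insert (T X' η) X y))) := by
  rw [← hT.ip_contract_insert, α.mul_mulInv, hT.natural, hT.map_unit, β.ip_map,
    ← β.unitL_unitInv (β.map (dag R) _), β.ip_unitL, β.unitInv_unitL, ofHom_ip_lact]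

/-- Rigidity makes every `T(ξ)` adjointable, although the isometries `u_X` need not be. -/
lemma mem_Adj (hT : IsCocycleFamily α β φ T) (X : 𝒞) (ξ : α.obj X) :
    T X ξ ∈ Adj (Corr.self B).toHilbMod (β.obj X).toHilbMod := by
  let M : Submodule ℂ (α.obj X) :=
    (Adj (Corr.self B).toHilbMod (β.obj X).toHilbMod).comap (T X).toLinearMap
  suffices h : M = ⊤ from (h ▸ Submodule.mem_top : ξ ∈ M)
  refine α.eq_top_of_lact_rsmul_mem M ((isClosed_Adj (E := (Corr.self B).toHilbMod)
    (F := (β.obj X).toHilbMod)).preimage (T X).continuous) fun a x a' => ?_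
  obtain ⟨X', R, R', hR, -⟩ := exists_conj X
  have h1 := α.contract_conj R R' hR x a' (star a)
  rw [star_star] at h1
  rw [← h1]
  exact ⟨(φ (star a')).fst ∘L β.unitInv ∘L β.map (dag R) ∘L β.insert (T X' _) X,
    fun b y => hT.ip_contract_conj R _ a' b y⟩

end IsCocycleFamily

variable {α : CAction.{w₁} 𝒞 A} {β : CAction.{w₂} 𝒞 B} {φ : A →⋆ₙₐ[ℂ] 𝓜(ℂ, B)}

/-! ### Isometries and families of operators -/

namespace Corr

variable {F : Corr.{w} B B}

lemma lUnitHom_lact (φ : A →⋆ₙₐ[ℂ] 𝓜(ℂ, B)) (hF : F.Nondegenerate) (b : B) (y : F) :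
    lUnitHom φ F (F.lact b y) = tmul (ofHom φ) F b y := lUnit_lact hF b y

lemma lUnitHom_rsmul (φ : A →⋆ₙₐ[ℂ] 𝓜(ℂ, B)) (hF : F.Nondegenerate) (y : F) (b : B) :
    lUnitHom φ F (F.rsmul y b) = ((ofHom φ).tensor F).rsmul (lUnitHom φ F y) b :=
  lUnit_rsmul hF y b

lemma lUnitHom_multAct (φ : A →⋆ₙₐ[ℂ] 𝓜(ℂ, B)) (hF : F.Nondegenerate) (a : A) (y : F) :
    lUnitHom φ F (multAct F (φ a) y) = ((ofHom φ).tensor F).lact a (lUnitHom φ F y) :=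
  lUnit_multAct hF (φ a) y

lemma lUnitHom_injective (φ : A →⋆ₙₐ[ℂ] 𝓜(ℂ, B)) (hF : F.Nondegenerate) :
    Function.Injective (lUnitHom φ F) :=
  Function.LeftInverse.injective (g := lUnitAdj F) (lUnitAdj_lUnit hF)

lemma norm_lUnitHom (φ : A →⋆ₙₐ[ℂ] 𝓜(ℂ, B)) (hF : F.Nondegenerate) (y : F) :
    ‖lUnitHom φ F y‖ = ‖y‖ := norm_lUnit hF y

lemma lTensor_lUnitHom {F' : Corr.{w} B B} (φ : A →⋆ₙₐ[ℂ] 𝓜(ℂ, B)) (hF : F.Nondegenerate)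
    (hF' : F'.Nondegenerate) (S : F →L[ℂ] F')
    (hS : ∀ (x : F) (b : B), S (F.rsmul x b) = F'.rsmul (S x) b)
    (hS' : ∀ (a : B) (x : F), S (F.lact a x) = F'.lact a (S x)) (x : F) :
    lTensor (ofHom φ) F F' S (lUnitHom φ F x) = lUnitHom φ F' (S x) :=
  lTensor_lUnit hF hF' S hS hS' x

lemma tmul_rsmul_ofHom {G : Corr.{w₃} A A} (φ : A →⋆ₙₐ[ℂ] 𝓜(ℂ, B)) (x : G) (b c : B) :
    (G.tensor (ofHom φ)).rsmul (tmul G (ofHom φ) x b) c =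
      tmul G (ofHom φ) x (b * c : B) := rsmul_tmul (F := ofHom φ) x b c

end Corr

section Pentagon

variable {T : ∀ X : 𝒞, α.obj X →L[ℂ] B →L[ℂ] β.obj X} {X Y : 𝒞}
  (U : (α.obj X).tensor (ofHom φ) →L[ℂ] (ofHom φ).tensor (β.obj X))

/-- The right hand side of the pentagon identity is `l` composed with the right hand side of the
multiplicativity condition. -/
lemma pentagon_insert
    (hU : ∀ (ξ : α.obj X) (b : B), U (tmul _ (ofHom φ) ξ b) = lUnitHom φ (β.obj X) (T X ξ b))
    (hUr : ∀ z (b : B), U (((α.obj X).tensor (ofHom φ)).rsmul z b) =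
      ((ofHom φ).tensor (β.obj X)).rsmul (U z) b)
    (hTr : ∀ (ξ : α.obj X) (b c : B), T X ξ (b * c) = (β.obj X).rsmul (T X ξ b) c)
    (ξ : α.obj X) (y : β.obj Y) :
    lTensor (ofHom φ) ((β.obj X).tensor (β.obj Y)) (β.obj (X ⊗ Y)) (β.mul X Y).toCLM
        (assoc (ofHom φ) (β.obj X) (β.obj Y)
          (rTensor ((α.obj X).tensor (ofHom φ)) ((ofHom φ).tensor (β.obj X)) (β.obj Y) U
            (assocInv (α.obj X) (ofHom φ) (β.obj Y)
              (tmul _ _ ξ (lUnitHom φ (β.obj Y) y))))) =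
      lUnitHom φ (β.obj (X ⊗ Y)) (β.insert (T X ξ) Y y) := by
  have : lTensor (ofHom φ) ((β.obj X).tensor (β.obj Y)) (β.obj (X ⊗ Y)) (β.mul X Y).toCLM ∘L
      assoc (ofHom φ) (β.obj X) (β.obj Y) ∘L
      rTensor ((α.obj X).tensor (ofHom φ)) ((ofHom φ).tensor (β.obj X)) (β.obj Y) U ∘L
      assocInv (α.obj X) (ofHom φ) (β.obj Y) ∘L
      tmulL (α.obj X) ((ofHom φ).tensor (β.obj Y)) ξ ∘L lUnitHom φ (β.obj Y) =
      lUnitHom φ (β.obj (X ⊗ Y)) ∘L β.insert (T X ξ) Y := by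
    refine (β.nondegenerate Y).clm_ext fun b y => ?_
    simp only [ContinuousLinearMap.comp_apply, tmulL_apply]
    have h1 := assocInv_tmul (F := ofHom φ) (G := β.obj Y) ξ b y
    have h2 := rTensor_tmul (F := β.obj Y) U hUr (tmul _ (ofHom φ) ξ b) y
    rw [hU] at h2
    rw [lUnitHom_lact φ (β.nondegenerate Y), β.insert_lact _ (hTr ξ)]
    refine (congrArg _ (congrArg _ ((congrArg _ h1).trans h2))).trans ?_
    exact lTensor_assoc_lUnit (β.nondegenerate X) (β.nondegenerate (X ⊗ Y)) (β.mul X Y).toCLM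
      (β.mul X Y).map_rsmul (β.mul X Y).map_lact (T X ξ b) y
  exact DFunLike.congr_fun this y

end Pentagon

namespace EquivariantStructure

/-- The pentagon identity is the multiplicativity condition on the operators `T`: at
`(ξ ⊗ ζ) ⊗ b`, the two sides of the former are the images under `l` of the two sides of the
latter. -/
lemma pentagon_iff {T : ∀ X : 𝒞, α.obj X →L[ℂ] B →L[ℂ] β.obj X}
    (u : ∀ X : 𝒞, (α.obj X).tensor (ofHom φ) →ₗᵢ[ℂ] (ofHom φ).tensor (β.obj X))
    (hu : ∀ (X : 𝒞) (ξ : α.obj X) (b : B),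
      u X (tmul _ (ofHom φ) ξ b) = lUnitHom φ (β.obj X) (T X ξ b))
    (hur : ∀ (X : 𝒞) z (b : B), u X (((α.obj X).tensor (ofHom φ)).rsmul z b) =
      ((ofHom φ).tensor (β.obj X)).rsmul (u X z) b)
    (hul : ∀ (X : 𝒞) (a : A) z, u X (((α.obj X).tensor (ofHom φ)).lact a z) =
      ((ofHom φ).tensor (β.obj X)).lact a (u X z))
    (hTr : ∀ (X : 𝒞) (ξ : α.obj X) (b c : B), T X ξ (b * c) = (β.obj X).rsmul (T X ξ b) c)
    (X Y : 𝒞) :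
    (∀ z, u (X ⊗ Y) (rTensor ((α.obj X).tensor (α.obj Y)) (α.obj (X ⊗ Y)) (ofHom φ)
        (α.mul X Y).toCLM z) =
      lTensor (ofHom φ) ((β.obj X).tensor (β.obj Y)) (β.obj (X ⊗ Y)) (β.mul X Y).toCLM
        (assoc (ofHom φ) (β.obj X) (β.obj Y)
          (rTensor ((α.obj X).tensor (ofHom φ)) ((ofHom φ).tensor (β.obj X)) (β.obj Y)
              (u X).toContinuousLinearMap
            (assocInv (α.obj X) (ofHom φ) (β.obj Y)
              (lTensor (α.obj X) ((α.obj Y).tensor (ofHom φ)) ((ofHom φ).tensor (β.obj Y))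
                  (u Y).toContinuousLinearMap
                (assoc (α.obj X) (α.obj Y) (ofHom φ) z)))))) ↔
    ∀ (ξ : α.obj X) (ζ : α.obj Y) (b : B),
      T (X ⊗ Y) ((α.mul X Y).toEquiv (tmul _ _ ξ ζ)) b = β.insert (T X ξ) Y (T Y ζ b) := by
  have hl : ∀ (ξ : α.obj X) (ζ : α.obj Y) (b : B),
      u (X ⊗ Y) (rTensor ((α.obj X).tensor (α.obj Y)) (α.obj (X ⊗ Y)) (ofHom φ)
        (α.mul X Y).toCLM (tmul _ (ofHom φ) (tmul _ _ ξ ζ) b)) =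
      lUnitHom φ (β.obj (X ⊗ Y)) (T (X ⊗ Y) ((α.mul X Y).toEquiv (tmul _ _ ξ ζ)) b) := by
    intro ξ ζ b
    rw [← hu]
    exact congrArg _ (rTensor_tmul (F := ofHom φ) (α.mul X Y).toCLM (α.mul X Y).map_rsmul
      (tmul _ _ ξ ζ) b)
  have hr : ∀ (ξ : α.obj X) (ζ : α.obj Y) (b : B),
      lTensor (ofHom φ) ((β.obj X).tensor (β.obj Y)) (β.obj (X ⊗ Y)) (β.mul X Y).toCLM
        (assoc (ofHom φ) (β.obj X) (β.obj Y)
          (rTensor ((α.obj X).tensor (ofHom φ)) ((ofHom φ).tensor (β.obj X)) (β.obj Y)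
              (u X).toContinuousLinearMap
            (assocInv (α.obj X) (ofHom φ) (β.obj Y)
              (lTensor (α.obj X) ((α.obj Y).tensor (ofHom φ)) ((ofHom φ).tensor (β.obj Y))
                  (u Y).toContinuousLinearMap
                (assoc (α.obj X) (α.obj Y) (ofHom φ)
                  (tmul _ (ofHom φ) (tmul _ _ ξ ζ) b)))))) =
      lUnitHom φ (β.obj (X ⊗ Y)) (β.insert (T X ξ) Y (T Y ζ b)) := by
    intro ξ ζ b
    rw [← pentagon_insert (u X).toContinuousLinearMap (hu X) (hur X) (hTr X) ξ (T Y ζ b), ← hu]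
    refine congrArg _ (congrArg _ (congrArg _ (congrArg _ ?_)))
    exact (congrArg _ (assoc_tmul (G := ofHom φ) ξ ζ b)).trans
      (lTensor_tmul (u Y).toContinuousLinearMap (hur Y) (hul Y) ξ (tmul _ (ofHom φ) ζ b))
  constructor
  · intro h ξ ζ b
    apply lUnitHom_injective φ (β.nondegenerate _)
    rw [← hl, h, hr]
  · intro h z
    have : (u (X ⊗ Y)).toContinuousLinearMap ∘L rTensor ((α.obj X).tensor (α.obj Y))
          (α.obj (X ⊗ Y)) (ofHom φ) (α.mul X Y).toCLM =
        lTensor (ofHom φ) ((β.obj X).tensor (β.obj Y)) (β.obj (X ⊗ Y)) (β.mul X Y).toCLM ∘L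
        assoc (ofHom φ) (β.obj X) (β.obj Y) ∘L
        rTensor ((α.obj X).tensor (ofHom φ)) ((ofHom φ).tensor (β.obj X)) (β.obj Y)
          (u X).toContinuousLinearMap ∘L
        assocInv (α.obj X) (ofHom φ) (β.obj Y) ∘L
        lTensor (α.obj X) ((α.obj Y).tensor (ofHom φ)) ((ofHom φ).tensor (β.obj Y))
          (u Y).toContinuousLinearMap ∘L
        assoc (α.obj X) (α.obj Y) (ofHom φ) := by
      refine tensor_ext₃ fun ξ ζ (b : B) => ?_
      refine (hl ξ ζ b).trans ?_
      rw [h]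
      exact (hr ξ ζ b).symm
    exact DFunLike.congr_fun this z

/-- The operators `T_X(ξ) b = l⋆ u_X(ξ ⊗ b)` of an equivariant structure. -/
noncomputable def op (𝕦 : EquivariantStructure α β (ofHom φ)) (X : 𝒞) :
    α.obj X →L[ℂ] B →L[ℂ] β.obj X :=
  (ContinuousLinearMap.compL ℂ (ofHom φ) ((α.obj X).tensor (ofHom φ)) (β.obj X)
    ((show (ofHom φ).tensor (β.obj X) →L[ℂ] β.obj X from lUnitAdj (β.obj X)) ∘L
      (𝕦.u X).toContinuousLinearMap)) ∘L tmulL (α.obj X) (ofHom φ)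

lemma u_tmul (𝕦 : EquivariantStructure α β (ofHom φ)) (X : 𝒞) (ξ : α.obj X) (b : B) :
    𝕦.u X (tmul _ (ofHom φ) ξ b) = lUnitHom φ (β.obj X) (𝕦.op X ξ b) :=
  (lUnit_lUnitAdj (β.nondegenerate X) _).symm

lemma op_mul_right (𝕦 : EquivariantStructure α β (ofHom φ)) (X : 𝒞) (ξ : α.obj X) (b c : B) :
    𝕦.op X ξ (b * c) = (β.obj X).rsmul (𝕦.op X ξ b) c := by
  apply lUnitHom_injective φ (β.nondegenerate _)
  rw [lUnitHom_rsmul φ (β.nondegenerate X), ← u_tmul, ← u_tmul, ← 𝕦.u_rsmul, tmul_rsmul_ofHom]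

lemma isCocycleFamily (𝕦 : EquivariantStructure α β (ofHom φ)) :
    IsCocycleFamily α β φ 𝕦.op where
  ip X η ξ b c := by
    have h := HilbMod.ip_map_of_isometry (E := ((α.obj X).tensor (ofHom φ)).toHilbMod)
      (F := ((ofHom φ).tensor (β.obj X)).toHilbMod) (𝕦.u X) (𝕦.u_rsmul X)
      (tmul _ (ofHom φ) η b) (tmul _ (ofHom φ) ξ c)
    rw [u_tmul, u_tmul] at h
    refine (ip_lUnit (β.nondegenerate X) _ _).symm.trans (h.trans ?_)
    exact ip_tmul (F := ofHom φ) η ξ b c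
  lact X a ξ b := by
    apply lUnitHom_injective φ (β.nondegenerate _)
    rw [lUnitHom_multAct φ (β.nondegenerate X), ← u_tmul, ← u_tmul, ← 𝕦.u_lact]
    exact congrArg _ (lact_tmul (F := ofHom φ) a ξ b).symm
  mul X Y := (pentagon_iff 𝕦.u 𝕦.u_tmul 𝕦.u_rsmul 𝕦.u_lact 𝕦.op_mul_right X Y).1
    (𝕦.pentagon X Y)
  natural {X Y} f ξ b := by
    apply lUnitHom_injective φ (β.nondegenerate _)
    rw [← lTensor_lUnitHom φ (β.nondegenerate X) (β.nondegenerate Y) (β.map f) (β.map_rsmul f)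
      (β.map_lact f), ← u_tmul, ← u_tmul, ← 𝕦.natural]
    exact congrArg _ (rTensor_tmul (F := ofHom φ) (α.map f) (α.map_rsmul f) ξ b).symm

/-- Equivariant structures agree if their isometries agree on elementary tensors. -/
lemma ext_tmul {𝕦 𝕦' : EquivariantStructure α β (ofHom φ)}
    (h : ∀ (X : 𝒞) (ξ : α.obj X) (b : B),
      𝕦.u X (tmul _ (ofHom φ) ξ b) = 𝕦'.u X (tmul _ (ofHom φ) ξ b)) : 𝕦 = 𝕦' := by
  have hu : 𝕦.u = 𝕦'.u := by
    funext X
    have : (𝕦.u X).toContinuousLinearMap = (𝕦'.u X).toContinuousLinearMap :=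
      tensor_ext fun ξ (b : B) => h X ξ b
    exact LinearIsometry.ext fun z => DFunLike.congr_fun this z
  cases 𝕦
  cases 𝕦'
  congr

end EquivariantStructure

namespace IsCocycleFamily

variable {T : ∀ X : 𝒞, α.obj X →L[ℂ] B →L[ℂ] β.obj X}

/-- The algebraic map `ξ ⊗ b ↦ T_X(ξ) b`. -/
noncomputable def algMap (T : ∀ X : 𝒞, α.obj X →L[ℂ] B →L[ℂ] β.obj X) (X : 𝒞) :
    (α.obj X ⊗[ℂ] ofHom φ) →ₗ[ℂ] β.obj X :=
  TensorProduct.lift (show α.obj X →ₗ[ℂ] ofHom φ →ₗ[ℂ] β.obj X from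
    (show α.obj X →ₗ[ℂ] B →ₗ[ℂ] β.obj X from
      (ContinuousLinearMap.coeLM ℂ).comp (T X).toLinearMap))

lemma ip_algMap (hT : IsCocycleFamily α β φ T) (X : 𝒞) (z w : α.obj X ⊗[ℂ] ofHom φ) :
    (β.obj X).form.ip (algMap T X z) (algMap T X w) =
      tensorIp (α.obj X).toHilbMod (ofHom φ) z w := by
  induction z using TensorProduct.induction_on with
  | zero => simp
  | add z z' hz hz' => simp only [map_add, LinearMap.add_apply, hz, hz']
  | tmul η b =>
    induction w using TensorProduct.induction_on with
    | zero => simp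
    | add w w' hw hw' => simp only [map_add, hw, hw']
    | tmul ξ c => exact hT.ip X η ξ b c

lemma norm_algMap (hT : IsCocycleFamily α β φ T) (X : 𝒞) (z : α.obj X ⊗[ℂ] ofHom φ) :
    ‖algMap T X z‖ = ‖ofAlg (α.obj X) (ofHom φ) z‖ := by
  refine (sq_eq_sq₀ (norm_nonneg _) (norm_nonneg _)).1 ?_
  rw [(β.obj X).norm_sq, hT.ip_algMap, norm_ofAlg_sq]

/-- The extension of `ξ ⊗ b ↦ T_X(ξ) b` to the interior tensor product. -/
noncomputable def extend (T : ∀ X : 𝒞, α.obj X →L[ℂ] B →L[ℂ] β.obj X) (X : 𝒞) :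
    (α.obj X).tensor (ofHom φ) →L[ℂ] β.obj X :=
  (algMap T X).extendOfNorm (ofAlg (α.obj X) (ofHom φ))

lemma extend_ofAlg (hT : IsCocycleFamily α β φ T) (X : 𝒞) (z : α.obj X ⊗[ℂ] ofHom φ) :
    extend T X (ofAlg (α.obj X) (ofHom φ) z) = algMap T X z :=
  LinearMap.extendOfNorm_eq (denseRange_ofAlg _ _) ⟨1, fun z => by
    rw [one_mul, hT.norm_algMap]⟩ z

lemma extend_tmul (hT : IsCocycleFamily α β φ T) (X : 𝒞) (ξ : α.obj X) (b : B) :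
    extend T X (tmul _ (ofHom φ) ξ b) = T X ξ b := hT.extend_ofAlg X _

/-- The isometry `u_X` of a cocycle family. -/
noncomputable def isometry (hT : IsCocycleFamily α β φ T) (X : 𝒞) :
    (α.obj X).tensor (ofHom φ) →ₗᵢ[ℂ] (ofHom φ).tensor (β.obj X) where
  toLinearMap := (lUnitHom φ (β.obj X) ∘L extend T X).toLinearMap
  norm_map' z := by
    change ‖lUnitHom φ (β.obj X) (extend T X z)‖ = ‖z‖
    rw [norm_lUnitHom φ (β.nondegenerate X)]
    refine (denseRange_ofAlg _ _).induction_on (p := fun z => ‖extend T X z‖ = ‖z‖) z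
      (isClosed_eq (extend T X).continuous.norm continuous_norm) fun z => ?_
    rw [hT.extend_ofAlg, hT.norm_algMap]

lemma isometry_tmul (hT : IsCocycleFamily α β φ T) (X : 𝒞) (ξ : α.obj X) (b : B) :
    hT.isometry X (tmul _ (ofHom φ) ξ b) = lUnitHom φ (β.obj X) (T X ξ b) :=
  congrArg _ (hT.extend_tmul X ξ b)

lemma isometry_lact (hT : IsCocycleFamily α β φ T) (X : 𝒞) (a : A)
    (z : (α.obj X).tensor (ofHom φ)) :
    hT.isometry X (((α.obj X).tensor (ofHom φ)).lact a z) =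
      ((ofHom φ).tensor (β.obj X)).lact a (hT.isometry X z) := by
  have : (hT.isometry X).toContinuousLinearMap ∘L lactL ((α.obj X).tensor (ofHom φ)) a =
      lactL ((ofHom φ).tensor (β.obj X)) a ∘L (hT.isometry X).toContinuousLinearMap := by
    refine tensor_ext fun ξ (b : B) => ?_
    change hT.isometry X (((α.obj X).tensor (ofHom φ)).lact a (tmul _ _ ξ b)) =
      ((ofHom φ).tensor (β.obj X)).lact a (hT.isometry X (tmul _ _ ξ b))
    refine (congrArg _ (lact_tmul (F := ofHom φ) a ξ b)).trans ?_
    refine (hT.isometry_tmul X _ b).trans ?_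
    rw [hT.lact, lUnitHom_multAct φ (β.nondegenerate X)]
    exact congrArg _ (hT.isometry_tmul X ξ b).symm
  exact DFunLike.congr_fun this z

lemma isometry_rsmul (hT : IsCocycleFamily α β φ T) (X : 𝒞)
    (z : (α.obj X).tensor (ofHom φ)) (c : B) :
    hT.isometry X (((α.obj X).tensor (ofHom φ)).rsmul z c) =
      ((ofHom φ).tensor (β.obj X)).rsmul (hT.isometry X z) c := by
  have : (hT.isometry X).toContinuousLinearMap ∘L
        ((α.obj X).tensor (ofHom φ)).rsmulL c =
      ((ofHom φ).tensor (β.obj X)).rsmulL c ∘L (hT.isometry X).toContinuousLinearMap := by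
    refine tensor_ext fun ξ (b : B) => ?_
    change hT.isometry X (((α.obj X).tensor (ofHom φ)).rsmul (tmul _ _ ξ b) c) =
      ((ofHom φ).tensor (β.obj X)).rsmul (hT.isometry X (tmul _ _ ξ b)) c
    refine (congrArg _ (tmul_rsmul_ofHom φ ξ b c)).trans ?_
    refine (hT.isometry_tmul X ξ _).trans ?_
    rw [hT.map_mul_right, lUnitHom_rsmul φ (β.nondegenerate X)]
    exact congrArg (fun w => ((ofHom φ).tensor (β.obj X)).rsmul w c) (hT.isometry_tmul X ξ b).symm
  exact DFunLike.congr_fun this z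

/-- The equivariant structure `u_X(ξ ⊗ b) = l (T_X(ξ) b)` of a cocycle family. -/
noncomputable def toEquivariantStructure (hT : IsCocycleFamily α β φ T) :
    EquivariantStructure α β (ofHom φ) where
  u := hT.isometry
  u_lact := hT.isometry_lact
  u_rsmul := hT.isometry_rsmul
  natural {X Y} f z := by
    have : (hT.isometry Y).toContinuousLinearMap ∘L
        rTensor (α.obj X) (α.obj Y) (ofHom φ) (α.map f) =
        lTensor (ofHom φ) (β.obj X) (β.obj Y) (β.map f) ∘L
          (hT.isometry X).toContinuousLinearMap := by
      refine tensor_ext fun ξ (b : B) => ?_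
      change hT.isometry Y (rTensor _ _ _ (α.map f) (tmul _ _ ξ b)) =
        lTensor _ _ _ (β.map f) (hT.isometry X (tmul _ _ ξ b))
      refine (congrArg _ (rTensor_tmul (F := ofHom φ) (α.map f) (α.map_rsmul f) ξ b)).trans ?_
      refine (hT.isometry_tmul Y _ b).trans ?_
      rw [hT.natural, ← lTensor_lUnitHom φ (β.nondegenerate X) (β.nondegenerate Y) (β.map f)
        (β.map_rsmul f) (β.map_lact f)]
      exact congrArg _ (hT.isometry_tmul X ξ b).symm
    exact DFunLike.congr_fun this z
  pentagon X Y := (EquivariantStructure.pentagon_iff hT.isometry hT.isometry_tmul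
    hT.isometry_rsmul hT.isometry_lact hT.map_mul_right X Y).2 (hT.mul X Y)

/-- The compatible family of a cocycle family. -/
noncomputable def toCompatibleFamily (hT : IsCocycleFamily α β φ T) : CompatibleFamily α β φ where
  map X := LinearMap.codRestrict (Adj (Corr.self B).toHilbMod (β.obj X).toHilbMod)
    (show α.obj X →ₗ[ℂ] (Corr.self B →L[ℂ] β.obj X) from (T X).toLinearMap) (hT.mem_Adj X)
  map_unit := hT.map_unit
  map_lact := hT.lact
  map_rsmul := hT.map_rsmul
  map_ip X η ξ := by
    refine ContinuousLinearMap.ext fun c => HilbMod.ext_ip_right (E := (Corr.self B).toHilbMod)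
      fun b => ?_
    refine (hT.ip X η ξ b c).symm.trans ?_
    exact ip_adjoint (E := (Corr.self B).toHilbMod) (F := (β.obj X).toHilbMod) ⟨T X η, _⟩ b _
  map_mul := hT.mul
  map_natural := hT.natural

end IsCocycleFamily

namespace CompatibleFamily

lemma form_ip (Φ : CompatibleFamily α β φ) (X : 𝒞) (η ξ : α.obj X) (b c : B) :
    (β.obj X).form.ip ((Φ.map X η).1 b) ((Φ.map X ξ).1 c) =
      star b * (φ ((α.obj X).form.ip η ξ)).fst c := by
  refine (ip_adjoint (E := (Corr.self B).toHilbMod) (F := (β.obj X).toHilbMod)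
    (Φ.map X η) b _).trans ?_
  have h := DFunLike.congr_fun (Φ.map_ip X η ξ) c
  exact congrArg (fun d : B => star b * d) h.symm

/-- The operators of a compatible family depend boundedly on `ξ`: the inner product condition gives
`‖φ_X(ξ) b‖ = ‖ξ ⊗ b‖`. -/
noncomputable def op (Φ : CompatibleFamily α β φ) (X : 𝒞) : α.obj X →L[ℂ] B →L[ℂ] β.obj X :=
  LinearMap.mkContinuous
    (show α.obj X →ₗ[ℂ] (B →L[ℂ] β.obj X) from (Adj _ _).subtype.comp (Φ.map X)) 1 fun ξ => by
    rw [one_mul]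
    refine ContinuousLinearMap.opNorm_le_bound _ (norm_nonneg _) fun b => ?_
    refine le_trans (le_of_eq ?_) (norm_tmul_le (α.obj X) (ofHom φ) ξ b)
    refine (sq_eq_sq₀ (norm_nonneg _) (norm_nonneg _)).1 ?_
    refine Eq.trans ?_ (norm_ofAlg_sq (α.obj X) (ofHom φ) (ξ ⊗ₜ (show ofHom φ from b))).symm
    refine ((β.obj X).norm_sq _).trans ?_
    exact congrArg _ (Φ.form_ip X ξ ξ b b)

lemma isCocycleFamily (Φ : CompatibleFamily α β φ) : IsCocycleFamily α β φ Φ.op where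
  ip := Φ.form_ip
  lact := Φ.map_lact
  mul := Φ.map_mul
  natural := Φ.map_natural

lemma ext_apply {Φ Φ' : CompatibleFamily α β φ}
    (h : ∀ (X : 𝒞) (ξ : α.obj X) (b : B), (Φ.map X ξ).1 b = (Φ'.map X ξ).1 b) : Φ = Φ' := by
  have hm : Φ.map = Φ'.map := by
    funext X
    exact LinearMap.ext fun ξ => Subtype.ext (ContinuousLinearMap.ext fun b => h X ξ b)
  cases Φ
  cases Φ'
  congr

end CompatibleFamily

variable (α β φ) in
/-- The correspondence between equivariant structures on `_φ B` and compatible families. -/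
noncomputable def equivariantStructureEquiv :
    EquivariantStructure α β (ofHom φ) ≃ CompatibleFamily α β φ where
  toFun 𝕦 := 𝕦.isCocycleFamily.toCompatibleFamily
  invFun Φ := Φ.isCocycleFamily.toEquivariantStructure
  left_inv 𝕦 := EquivariantStructure.ext_tmul fun X ξ b =>
    (𝕦.isCocycleFamily.toCompatibleFamily.isCocycleFamily.isometry_tmul X ξ b).trans
      (𝕦.u_tmul X ξ b).symm
  right_inv Φ := CompatibleFamily.ext_apply fun X ξ b => by
    apply lUnitHom_injective φ (β.nondegenerate X)
    exact (EquivariantStructure.u_tmul _ X ξ b).symm.trans (Φ.isCocycleFamily.isometry_tmul X ξ b)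

end CocycleRep

theorem mainTheorem8 {𝒞 : Type*} [Category 𝒞] [Preadditive 𝒞] [Linear ℂ 𝒞] [MonoidalCategory 𝒞]
    [MonoidalPreadditive 𝒞] [MonoidalLinear ℂ 𝒞] [CocycleRep.UnitaryTensorCategory 𝒞]
    {A : Type*} [NonUnitalCStarAlgebra A] [PartialOrder A] [StarOrderedRing A]
    {B : Type*} [NonUnitalCStarAlgebra B] [PartialOrder B] [StarOrderedRing B]
    (α : CocycleRep.CAction 𝒞 A) (β : CocycleRep.CAction 𝒞 B) (φ : A →⋆ₙₐ[ℂ] 𝓜(ℂ, B)) :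
    ∃ Ψ : CocycleRep.EquivariantStructure α β (CocycleRep.Corr.ofHom φ) ≃
        CocycleRep.CompatibleFamily α β φ,
      ∀ (𝕦 : CocycleRep.EquivariantStructure α β (CocycleRep.Corr.ofHom φ)) (X : 𝒞)
        (ξ : α.obj X) (b : B),
        𝕦.u X (CocycleRep.Corr.tmul (α.obj X) (CocycleRep.Corr.ofHom φ) ξ b) =
          CocycleRep.Corr.lUnitHom φ (β.obj X) (((Ψ 𝕦).map X ξ).1 b) :=
  ⟨CocycleRep.equivariantStructureEquiv α β φ, fun 𝕦 X ξ b => 𝕦.u_tmul X ξ b⟩
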